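/- Let $p_1,p_2,\alpha_0,\alpha_1,\beta_0,\beta_1,\gamma_0,\gamma_1,\delta_0,\delta_1$ be real numbers with $p_1\neq 0$, $p_2\neq0$, $|\alpha_0|+|\alpha_1|\neq0$, $|\beta_0|+|\beta_1|\neq 0$ and $p_1\delta_0=p_2\gamma_1$. Put $p(x)=p_1$ for $x\in(-1,0)$ and $p(x)=p_2$ for $x\in(0,1)$. Write $L_2=L_2(-1,0)\oplus L_2(0,1)$ and $W_2^2=W_2^2(-1,0)\oplus W_2^2(0,1)$ (complex-valued functions, Hilbert direct sums; $\|u\|^2_{W_2^2(a,b)}=\sum_{k=0}^{2}\|u^{(k)}\|^2_{L_2(a,b)}$). Let $A$ be a linear operator in $L_2$ whose domain contains $W_2^2$ and which acts compactly from $W_2^2$ to $L_2$. Let $\pounds$ be the operator in $L_2$ defined by $\pounds u=p(x)u''+Au$ on the domain of all $u\in W_2^2$ that satisfy $$\alpha_0u(-1)+\alpha_1u'(-1)=0,\qquad \beta_0u(1)+\beta_1u'(1)=0,$$ $$u'(0^-)=\gamma_0u(0^-)+\delta_0u(0^+),\qquad u'(0^+)=\gamma_1u(0^-)+\delta_1u(0^+).$$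 A number $\lambda\in\mathbb C$ is a regular value of $\pounds$ if $\pounds-\lambda I$ is a bijection from its domain onto $L_2$ with bounded inverse $R(\lambda,\pounds)=(\pounds-\lambda I)^{-1}:L_2\to L_2$; the spectrum is the set of the other $\lambda$. Then: 1. For every regular value $\lambda$ of $\pounds$, the resolvent $R(\lambda,\pounds)$ acts boundedly from $L_2$ into $W_2^2$, and it is a compact operator in $L_2$. 2. For every $\epsilon>0$ there are $R_\epsilon>0$ and $C(\epsilon)>0$ such that every $\lambda\in\mathbb C$ with $|\lambda|>R_\epsilon$ and $\epsilon<|\arg\lambda|<\pi-\epsilon$ (where $\arg\lambda\in(-\pi,\pi]$) is a regular value of $\pounds$, and $\|R(\lambda,\pounds)f\|_{W_2^2}\le C(\epsilon)\|f\|_{L_2}$ for all $f\in L_2$. 3. The spectrum of $\pounds$ is discrete: it consists only of eigenvalues $\lambda$ of finite algebraic multiplicity (that is, $\bigcup_{n\ge1}\ker(\pounds-\lambda I)^n$ is finite-dimensional), and it has no finite limit point. -/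

import Mathlib

open MeasureTheory Set
open scoped ContDiff Topology

noncomputable section

namespace TransSL

/-- The space `L₂(a, b)` of complex valued functions. -/
abbrev L2 (a b : ℝ) : Type := Lp ℂ 2 (volume.restrict (Ioo a b))

/-- `g` is the generalized derivative of `f` on `(a, b)`:
`∫ φ' f = - ∫ φ g` for all test functions `φ ∈ C_c^∞(a, b)`. -/
def IsWeakDeriv {a b : ℝ} (f g : L2 a b) : Prop :=
  ∀ φ : ℝ → ℝ, ContDiff ℝ ∞ φ → HasCompactSupport φ → tsupport φ ⊆ Ioo a b →
    ∫ x in Ioo a b, deriv φ x • f x = - ∫ x in Ioo a b, φ x • g x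

theorem integrable_smul_L2 {a b : ℝ} {φ : ℝ → ℝ} (h : Continuous φ) (hc : HasCompactSupport φ)
    (f : L2 a b) : Integrable (fun x => φ x • f x) (volume.restrict (Ioo a b)) := by
  have hf : Integrable (fun x => f x) (volume.restrict (Ioo a b)) :=
    (Lp.memLp f).integrable (by norm_num)
  obtain ⟨C, hC⟩ := hc.exists_bound_of_continuous h
  exact hf.bdd_smul C h.aestronglyMeasurable (Filter.Eventually.of_forall hC)

theorem IsWeakDeriv.zero {a b : ℝ} : IsWeakDeriv (0 : L2 a b) 0 := by
  intro φ _ _ _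
  have h0 : ∀ ψ : ℝ → ℝ, ∫ x in Ioo a b, ψ x • (0 : L2 a b) x = 0 := by
    intro ψ
    rw [integral_congr_ae (g := fun _ => (0 : ℂ)) ?_]
    · simp
    · filter_upwards [Lp.coeFn_zero ℂ 2 (volume.restrict (Ioo a b))] with x hx
      rw [hx, Pi.zero_apply, smul_zero]
  rw [h0, h0, neg_zero]

theorem integral_smul_add {a b : ℝ} {φ : ℝ → ℝ} (h : Continuous φ) (hc : HasCompactSupport φ)
    (f g : L2 a b) : ∫ x in Ioo a b, φ x • (f + g) x =
      (∫ x in Ioo a b, φ x • f x) + ∫ x in Ioo a b, φ x • g x := by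
  rw [← integral_add (integrable_smul_L2 h hc f) (integrable_smul_L2 h hc g)]
  refine integral_congr_ae ?_
  filter_upwards [Lp.coeFn_add f g] with x hx
  rw [hx, Pi.add_apply, smul_add]

theorem integral_smul_smul {a b : ℝ} (φ : ℝ → ℝ) (c : ℂ)
    (f : L2 a b) : ∫ x in Ioo a b, φ x • (c • f) x = c * ∫ x in Ioo a b, φ x • f x := by
  rw [← integral_const_mul]
  refine integral_congr_ae ?_
  filter_upwards [Lp.coeFn_smul c f] with x hx
  rw [hx, Pi.smul_apply, smul_comm, smul_eq_mul]

theorem IsWeakDeriv.add {a b : ℝ} {f g f' g' : L2 a b} (h : IsWeakDeriv f g)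
    (h' : IsWeakDeriv f' g') : IsWeakDeriv (f + f') (g + g') := by
  intro φ hφ hc hs
  rw [integral_smul_add (hφ.continuous_deriv (by simp)) hc.deriv, integral_smul_add hφ.continuous hc,
    h φ hφ hc hs, h' φ hφ hc hs]
  ring

theorem IsWeakDeriv.smul {a b : ℝ} {f g : L2 a b} (c : ℂ) (h : IsWeakDeriv f g) :
    IsWeakDeriv (c • f) (c • g) := by
  intro φ hφ hc hs
  rw [integral_smul_smul, integral_smul_smul, h φ hφ hc hs]
  ring

/-- Generalized derivatives are unique. -/
theorem IsWeakDeriv.eq_zero {a b : ℝ} {g : L2 a b} (h : IsWeakDeriv 0 g) : g = 0 := by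
  have key : ∀ᵐ x ∂(volume : Measure ℝ), x ∈ Ioo a b → g x = 0 := by
    refine isOpen_Ioo.ae_eq_zero_of_integral_contDiff_smul_eq_zero ?_ ?_
    · have hg : IntegrableOn (fun x => g x) (Ioo a b) :=
        (Lp.memLp g).integrable (by norm_num)
      exact hg.locallyIntegrableOn
    · intro φ hφ hc hs
      have h1 := h φ hφ hc hs
      have h2 : ∫ x in Ioo a b, deriv φ x • (0 : L2 a b) x = 0 := by
        have := integral_smul_smul (a := a) (b := b) (deriv φ) 0 0
        simpa only [zero_smul, zero_mul] using this
      rw [h2, eq_comm, neg_eq_zero] at h1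
      rw [← h1, setIntegral_eq_integral_of_forall_compl_eq_zero]
      intro x hx
      have : φ x = 0 := by
        by_contra hne
        exact hx (hs (subset_tsupport _ hne))
      simp [this]
  rw [Lp.eq_zero_iff_ae_eq_zero]
  exact (ae_restrict_iff' measurableSet_Ioo).2 key

/-- The Sobolev space `W₂ⁿ(a, b)`.  An element is stored as the tuple
`(f, f', …, f⁽ⁿ⁾)` of an `L₂` function and its generalized derivatives, which lie in `L₂(a, b)`;
the tuple is determined by `f` (see `Sob.toL2_injective`).  The norm inherited from the Hilbert sum
is the Sobolev norm `(∑ k ≤ n, ‖f⁽ᵏ⁾‖²)^{1/2}`. -/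
def Sob (n : ℕ) (a b : ℝ) : Submodule ℂ (PiLp 2 (fun _ : Fin (n + 1) => L2 a b)) where
  carrier := {w | ∀ k : Fin n, IsWeakDeriv (w k.castSucc) (w k.succ)}
  zero_mem' := fun _ => IsWeakDeriv.zero
  add_mem' := fun h h' k => (h k).add (h' k)
  smul_mem' := fun c _ h k => (h k).smul c

/-- The `k`-th generalized derivative of an element of `W₂ⁿ(a, b)`. -/
def Sob.der {n : ℕ} {a b : ℝ} (k : Fin (n + 1)) : Sob n a b →ₗ[ℂ] L2 a b where
  toFun w := w.1 k
  map_add' _ _ := rfl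
  map_smul' _ _ := rfl

theorem Sob.toL2_injective {n : ℕ} {a b : ℝ} :
    Function.Injective (Sob.der 0 : Sob n a b →ₗ[ℂ] L2 a b) := by
  rw [injective_iff_map_eq_zero]
  intro w hw
  have h : ∀ k : Fin (n + 1), w.1 k = 0 := by
    intro k
    induction k using Fin.induction with
    | zero => exact hw
    | succ k ih =>
      have := w.2 k
      rw [ih] at this
      exact this.eq_zero
  ext1
  ext1 k
  exact h k

/-- The Hilbert space `L₂(-1, 0) ⊕ L₂(0, 1)`. -/
abbrev H : Type := WithLp 2 (L2 (-1) 0 × L2 0 1)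

/-- The Hilbert space `W₂ⁿ(-1, 0) ⊕ W₂ⁿ(0, 1)`, with norm
`(‖u‖²_{W₂ⁿ(-1, 0)} + ‖u‖²_{W₂ⁿ(0, 1)})^{1/2}`. -/
abbrev W (n : ℕ) : Type := WithLp 2 (Sob n (-1) 0 × Sob n 0 1)

/-- The embedding of `W₂ⁿ(-1, 0) ⊕ W₂ⁿ(0, 1)` into `L₂(-1, 0) ⊕ L₂(0, 1)`. -/
def emb (n : ℕ) : W n →ₗ[ℂ] H where
  toFun w := WithLp.toLp 2 (Sob.der 0 w.fst, Sob.der 0 w.snd)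
  map_add' _ _ := rfl
  map_smul' _ _ := rfl

theorem emb_injective (n : ℕ) : Function.Injective (emb n) := by
  intro u v h
  have h' : (Sob.der 0 u.fst, Sob.der 0 u.snd) = (Sob.der 0 v.fst, Sob.der 0 v.snd) :=
    congrArg WithLp.ofLp h
  rw [Prod.mk.injEq] at h'
  have h1 := Sob.toL2_injective h'.1
  have h2 := Sob.toL2_injective h'.2
  exact WithLp.ofLp_injective 2 (Prod.ext h1 h2)

/-- The real coefficients of the equation and of the boundary and transmission conditions. -/
structure Coeffs where
  (p₁ p₂ α₀ α₁ β₀ β₁ γ₀ γ₁ δ₀ δ₁ : ℝ)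

/-- `g` is a representative of `f ∈ L₂(a, b)` that is continuous on `[a, b]`.  Elements of
`W₂¹(a, b)` have one, and its values at `a` and `b` are the boundary values of `f`. -/
def IsContRep {a b : ℝ} (f : L2 a b) (g : ℝ → ℂ) : Prop :=
  ContinuousOn g (Icc a b) ∧ f =ᵐ[volume.restrict (Ioo a b)] g

theorem IsContRep.zero {a b : ℝ} : IsContRep (0 : L2 a b) 0 :=
  ⟨continuousOn_const, Lp.coeFn_zero _ _ _⟩

theorem IsContRep.add {a b : ℝ} {f f' : L2 a b} {g g' : ℝ → ℂ} (h : IsContRep f g)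
    (h' : IsContRep f' g') : IsContRep (f + f') (g + g') :=
  ⟨h.1.add h'.1, (Lp.coeFn_add f f').trans (h.2.add h'.2)⟩

theorem IsContRep.smul {a b : ℝ} {f : L2 a b} {g : ℝ → ℂ} (c : ℂ) (h : IsContRep f g) :
    IsContRep (c • f) (c • g) :=
  ⟨h.1.const_smul c, (Lp.coeFn_smul c f).trans (h.2.const_smul c)⟩

/-- The functions `u ∈ W₂²(-1, 0) ⊕ W₂²(0, 1)` that satisfy the boundary conditions
`α₀ u(-1) + α₁ u'(-1) = 0`, `β₀ u(1) + β₁ u'(1) = 0` and the transmission conditions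
`u'(0⁻) = γ₀ u(0⁻) + δ₀ u(0⁺)`, `u'(0⁺) = γ₁ u(0⁻) + δ₁ u(0⁺)`.  Here `u₁`, `v₁` (`u₂`, `v₂`)
are the continuous representatives of `u`, `u'` on `[-1, 0]` (on `[0, 1]`). -/
def bcSpace (c : Coeffs) : Submodule ℂ (W 2) where
  carrier := {w | ∃ u₁ v₁ u₂ v₂ : ℝ → ℂ,
    IsContRep (Sob.der 0 w.fst) u₁ ∧ IsContRep (Sob.der 1 w.fst) v₁ ∧
    IsContRep (Sob.der 0 w.snd) u₂ ∧ IsContRep (Sob.der 1 w.snd) v₂ ∧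
    c.α₀ * u₁ (-1) + c.α₁ * v₁ (-1) = 0 ∧
    c.β₀ * u₂ 1 + c.β₁ * v₂ 1 = 0 ∧
    v₁ 0 - c.γ₀ * u₁ 0 - c.δ₀ * u₂ 0 = 0 ∧
    v₂ 0 - c.γ₁ * u₁ 0 - c.δ₁ * u₂ 0 = 0}
  zero_mem' := ⟨0, 0, 0, 0, IsContRep.zero, IsContRep.zero, IsContRep.zero, IsContRep.zero,
    by simp, by simp, by simp, by simp⟩
  add_mem' := by
    rintro w w' ⟨u₁, v₁, u₂, v₂, h1, h2, h3, h4, e1, e2, e3, e4⟩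
      ⟨u₁', v₁', u₂', v₂', h1', h2', h3', h4', e1', e2', e3', e4'⟩
    refine ⟨u₁ + u₁', v₁ + v₁', u₂ + u₂', v₂ + v₂', h1.add h1', h2.add h2', h3.add h3',
      h4.add h4', ?_, ?_, ?_, ?_⟩ <;> simp only [Pi.add_apply]
    · linear_combination e1 + e1'
    · linear_combination e2 + e2'
    · linear_combination e3 + e3'
    · linear_combination e4 + e4'
  smul_mem' := by
    rintro z w ⟨u₁, v₁, u₂, v₂, h1, h2, h3, h4, e1, e2, e3, e4⟩
    refine ⟨z • u₁, z • v₁, z • u₂, z • v₂, h1.smul z, h2.smul z, h3.smul z,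
      h4.smul z, ?_, ?_, ?_, ?_⟩ <;> simp only [Pi.smul_apply, smul_eq_mul]
    · linear_combination z * e1
    · linear_combination z * e2
    · linear_combination z * e3
    · linear_combination z * e4

/-- The differential expression `u ↦ p u''` on `W₂²(-1, 0) ⊕ W₂²(0, 1)`, where `p = p₁` on
`(-1, 0)` and `p = p₂` on `(0, 1)`. -/
def diffExpr (c : Coeffs) : W 2 →ₗ[ℂ] H where
  toFun w := WithLp.toLp 2 ((c.p₁ : ℂ) • Sob.der 2 w.fst, (c.p₂ : ℂ) • Sob.der 2 w.snd)
  map_add' u v := by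
    apply WithLp.ofLp_injective 2
    ext1 <;> simp
  map_smul' z u := by
    apply WithLp.ofLp_injective 2
    ext1 <;> simp [smul_comm]

/-- The operator `£₀` in `L₂(-1, 0) ⊕ L₂(0, 1)`: its domain is the set of functions in
`W₂²(-1, 0) ⊕ W₂²(0, 1)` that satisfy the boundary and transmission conditions, and
`£₀ u = p u''`. -/
def opL₀ (c : Coeffs) : H →ₗ.[ℂ] H where
  domain := (bcSpace c).map (emb 2)
  toFun := (diffExpr c ∘ₗ (bcSpace c).subtype) ∘ₗ
    ((bcSpace c).equivMapOfInjective (emb 2) (emb_injective 2)).symm.toLinearMap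

/-- `£₀ u = p u''`, evaluated on the function `emb 2 w` with `w` in the boundary value space. -/
theorem opL₀_apply (c : Coeffs) (w : W 2) (h : w ∈ bcSpace c)
    (hm : emb 2 w ∈ (opL₀ c).domain) : opL₀ c ⟨emb 2 w, hm⟩ = diffExpr c w := by
  have e := ((bcSpace c).equivMapOfInjective (emb 2) (emb_injective 2)).symm_apply_apply ⟨w, h⟩
  exact congrArg (fun v : bcSpace c => diffExpr c v.1) e

/-- The operator `£ u = p u'' + A u`, whose domain is that of `£₀` (when `A` is defined there). -/
def opL (c : Coeffs) (A : H →ₗ.[ℂ] H) : H →ₗ.[ℂ] H := opL₀ c + A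

theorem opL_domain (c : Coeffs) (A : H →ₗ.[ℂ] H) (h : (opL₀ c).domain ≤ A.domain) :
    (opL c A).domain = (opL₀ c).domain :=
  inf_eq_left.2 h

section Spectral

variable {E : Type*} [NormedAddCommGroup E] [NormedSpace ℂ E]

/-- The bounded operator `R`, defined on all of `E`, is the resolvent `(S - z I)⁻¹` of the
unbounded operator `S` at `z`. -/
def IsResolventAt (S : E →ₗ.[ℂ] E) (z : ℂ) (R : E →L[ℂ] E) : Prop :=
  (∀ f : E, ∃ h : R f ∈ S.domain, S ⟨R f, h⟩ - z • R f = f) ∧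
    ∀ u : S.domain, R (S u - z • (u : E)) = u

/-- The set of regular values of `S`. -/
def regularSet (S : E →ₗ.[ℂ] E) : Set ℂ := {z | ∃ R : E →L[ℂ] E, IsResolventAt S z R}

/-- The spectrum of `S`. -/
def spec (S : E →ₗ.[ℂ] E) : Set ℂ := (regularSet S)ᶜ

/-- `z` is an eigenvalue of `S`. -/
def IsEigenvalue (S : E →ₗ.[ℂ] E) (z : ℂ) : Prop :=
  ∃ u : S.domain, (u : E) ≠ 0 ∧ S u = z • (u : E)

/-- The kernel of `(S - z I)ⁿ`: `ker (S - z I)ⁿ⁺¹` consists of those `u` in the domain of `S` for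
which `(S - z I) u` lies in `ker (S - z I)ⁿ`. -/
def kerPow (S : E →ₗ.[ℂ] E) (z : ℂ) : ℕ → Submodule ℂ E
  | 0 => ⊥
  | n + 1 => ((kerPow S z n).comap (S.toFun - z • S.domain.subtype)).map S.domain.subtype

/-- The root lineal `⋃ₙ ker (S - z I)ⁿ`; its dimension is the algebraic multiplicity of `z`. -/
def rootLineal (S : E →ₗ.[ℂ] E) (z : ℂ) : Submodule ℂ E := ⨆ n, kerPow S z n

/-- The spectrum of `S` is discrete: it consists only of eigenvalues of finite algebraic
multiplicity and has no finite limit point. -/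
def HasDiscreteSpectrum (S : E →ₗ.[ℂ] E) : Prop :=
  (∀ z ∈ spec S, IsEigenvalue S z ∧ FiniteDimensional ℂ (rootLineal S z)) ∧
    ∀ z : ℂ, ¬ AccPt z (Filter.principal (spec S))

end Spectral

end TransSL

end

/-! Everything rests on an energy estimate away from the real axis. For `u` in the boundary value
space and `f = p u'' - z u`, Green's formula on each interval separately gives `p ‖u'‖² + z ‖u‖² = p
[ū u'] - ⟨u, f⟩`. The term `p ‖u'‖²` is real, whatever the sign of `p`, so imaginary parts control
`|Im z| ‖u‖²`, which is comparable with `|z| ‖u‖²` in the sector; the bound on `‖u'‖²` follows. The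
boundary and transmission conditions turn the products `u u'` at the end points into squares of
values of `u`, and these are at most a small multiple of `‖u'‖²` plus a large multiple of `‖u‖²`.
For large `|z|` both are absorbed, and the equation then bounds `u''`. The outcome,
`exists_apriori`, bounds `‖u‖` in `W₂²` and `|z| ‖u‖` in `L₂` by `‖f‖`. The second bound is what
admits `A`: by Ehrling's inequality `exists_norm_le_of_isCompactOperator`, `‖A u‖` is at most a
small multiple of the `W₂²` norm plus a multiple of the `L₂` norm (`exists_apriori_add`).

Existence comes from compactness. The map sending `u` to `p u''` and its initial data is bijective,
since one integrates twice. Replacing the initial data by the boundary forms and adding `A - z` is a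
compact perturbation, so injectivity implies bijectivity (`exists_solution_operator`). Hence every
`z` is either an eigenvalue or regular, and the estimate makes large `z` in the sector regular.

A resolvent maps boundedly into `W₂²` by the closed graph theorem, and the embedding into `L₂` is
compact. Root vectors of `£` at `z` are root vectors of `R(z₀, £)` at `(z - z₀)⁻¹`, so discreteness
reduces to Riesz theory: the root subspaces of a compact operator for eigenvalues bounded away from
zero have a finite dimensional span (`finiteDimensional_iSup_maxGenEigenspace`). -/

namespace TransSL

/-! ### Compact operators: Ehrling's inequality, the Fredholm alternative, root subspaces. -/

section Abstract

open Filter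

variable {E F G : Type*} [NormedAddCommGroup E] [InnerProductSpace ℂ E] [CompleteSpace E]
  [NormedAddCommGroup F] [InnerProductSpace ℂ F] [CompleteSpace F]
  [NormedAddCommGroup G] [InnerProductSpace ℂ G] [CompleteSpace G]

/-- A bounded sequence whose image under an injective operator tends to zero is weakly null. -/
theorem tendsto_inner_zero_of_injective (j : E →L[ℂ] F) (hj : Function.Injective j)
    {w : ℕ → E} {B : ℝ} (hw : ∀ n, ‖w n‖ ≤ B) (h0 : Tendsto (fun n => j (w n)) atTop (𝓝 0))
    (v : E) : Tendsto (fun n => inner ℂ v (w n)) atTop (𝓝 0) := by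
  have hB : 0 ≤ B := (norm_nonneg _).trans (hw 0)
  -- Injectivity of `j` makes the range of its adjoint dense; on vectors `j* y` the claim is
  -- immediate, and boundedness of `w` extends it to `v`.
  have hd : v ∈ closure ((LinearMap.range (ContinuousLinearMap.adjoint j).toLinearMap : Submodule ℂ E) : Set E) := by
    have h1 : (LinearMap.range (ContinuousLinearMap.adjoint j).toLinearMap)ᗮ = ⊥ := by
      rw [ContinuousLinearMap.orthogonal_range, ContinuousLinearMap.adjoint_adjoint]
      exact LinearMap.ker_eq_bot.2 hj
    have h2 := Submodule.topologicalClosure_eq_top_iff.2 h1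
    have : v ∈ (LinearMap.range (ContinuousLinearMap.adjoint j).toLinearMap).topologicalClosure := by
      rw [h2]; trivial
    exact this
  rw [Metric.tendsto_atTop]
  intro ε hε
  obtain ⟨_, ⟨y, rfl⟩, hy⟩ := Metric.mem_closure_iff.1 hd (ε / (2 * (B + 1))) (by positivity)
  have h1 : Tendsto (fun n => inner ℂ y (j (w n))) atTop (𝓝 0) := by
    simpa using (tendsto_const_nhds (x := y)).inner h0
  obtain ⟨N, hN⟩ := Metric.tendsto_atTop.1 h1 (ε / 2) (by positivity)
  refine ⟨N, fun n hn => ?_⟩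
  have h2 := hN n hn
  rw [dist_zero_right] at h2 ⊢
  have h3 : inner ℂ v (w n) = inner ℂ (v - ContinuousLinearMap.adjoint j y) (w n)
      + inner ℂ y (j (w n)) := by
    rw [inner_sub_left, ContinuousLinearMap.adjoint_inner_left]; ring
  rw [h3]
  have h4 : ‖inner ℂ (v - ContinuousLinearMap.adjoint j y) (w n)‖ ≤ ε / (2 * (B + 1)) * (B + 1) := by
    refine (norm_inner_le_norm _ _).trans ?_
    rw [dist_eq_norm] at hy
    exact mul_le_mul hy.le ((hw n).trans (by linarith)) (norm_nonneg _) (by positivity)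
  have h5 : ε / (2 * (B + 1)) * (B + 1) = ε / 2 := by field_simp
  calc _ ≤ _ := norm_add_le _ _
    _ < ε := by linarith

/-- Ehrling's inequality. -/
theorem exists_norm_le_of_isCompactOperator (j : E →L[ℂ] F) (hj : Function.Injective j)
    (K : E →L[ℂ] G) (hK : IsCompactOperator K) {δ : ℝ} (hδ : 0 < δ) :
    ∃ C : ℝ, 0 < C ∧ ∀ w, ‖K w‖ ≤ δ * ‖w‖ + C * ‖j w‖ := by
  by_contra! hcon
  -- Counterexamples with constants `n + 1`, normalized. As `‖K (w n)‖ ≤ ‖K‖`, they force `j (w n) →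
  -- 0`, while `‖K (w n)‖` stays above `δ`.
  have hc : ∀ n : ℕ, ∃ w : E, ‖w‖ = 1 ∧ δ + (n + 1) * ‖j w‖ < ‖K w‖ := by
    intro n
    obtain ⟨w, hw⟩ := hcon (n + 1) (by positivity)
    have hw0 : w ≠ 0 := by
      rintro rfl
      simp at hw
    have hp : 0 < ‖w‖ := norm_pos_iff.2 hw0
    refine ⟨((‖w‖⁻¹ : ℝ) : ℂ) • w, ?_, ?_⟩
    · rw [norm_smul]; simp [hp.ne']
    · rw [map_smul, map_smul, norm_smul, norm_smul]
      simp only [Complex.norm_real, norm_inv, norm_norm]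
      have := mul_lt_mul_of_pos_left hw (inv_pos.2 hp)
      refine lt_of_eq_of_lt ?_ this
      field_simp
  choose w hw1 hw2 using hc
  have hb : ∀ n, ‖K (w n)‖ ≤ ‖K‖ := fun n => by
    have := K.le_opNorm (w n); rwa [hw1, mul_one] at this
  have hj0 : Tendsto (fun n => j (w n)) atTop (𝓝 0) := by
    rw [tendsto_zero_iff_norm_tendsto_zero]
    have : Tendsto (fun n : ℕ => ‖K‖ * (1 / ((n : ℝ) + 1))) atTop (𝓝 0) := by
      simpa using tendsto_one_div_add_atTop_nhds_zero_nat.const_mul ‖K‖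
    refine squeeze_zero (fun _ => norm_nonneg _) (fun n => ?_) this
    have h1 := hw2 n
    have h2 := hb n
    rw [mul_one_div, le_div_iff₀ (by positivity)]
    linarith
  obtain ⟨S, hS, hS'⟩ := hK.image_closedBall_subset_compact (f := K.toLinearMap) 1
  obtain ⟨y, -, φ, hφ, hy⟩ := hS.tendsto_subseq (x := fun n => K (w n))
    (fun n => hS' ⟨w n, by simp [hw1], rfl⟩)
  -- The `w n` are weakly null, so any strong limit of a subsequence of `K (w n)` is zero.
  have hweak : Tendsto (fun n => inner ℂ y (K (w n))) atTop (𝓝 0) := by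
    simpa only [ContinuousLinearMap.adjoint_inner_left] using
      tendsto_inner_zero_of_injective j hj (fun n => (hw1 n).le) hj0 (ContinuousLinearMap.adjoint K y)
  have h1 := (tendsto_const_nhds (x := y)).inner (𝕜 := ℂ) hy
  have h2 := tendsto_nhds_unique h1 (hweak.comp hφ.tendsto_atTop)
  have hy0 : y = 0 := inner_self_eq_zero.1 h2
  rw [hy0] at hy
  have h3 := hy.norm
  rw [norm_zero] at h3
  have h4 : δ ≤ 0 := ge_of_tendsto' h3 fun n => by
    have h := hw2 (φ n)
    have : 0 ≤ ((φ n : ℝ) + 1) * ‖j (w (φ n))‖ := by positivity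
    simp only [Function.comp]
    linarith
  linarith

/-- A perturbation of the identity by a compact operator is bijective once it is injective. -/
theorem bijective_one_add_of_isCompactOperator {X : Type*} [NormedAddCommGroup X] [NormedSpace ℂ X]
    [CompleteSpace X] (K : X →L[ℂ] X) (hK : IsCompactOperator K)
    (hinj : Function.Injective ((1 : X →L[ℂ] X) + K)) :
    Function.Bijective ((1 : X →L[ℂ] X) + K) := by
  rcases hK.hasEigenvalue_or_mem_resolventSet (μ := -1) (by simp) with h | h
  · obtain ⟨v, hv⟩ := h.exists_hasEigenvector
    refine absurd (hinj (a₁ := v) (a₂ := 0) ?_) hv.2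
    have := hv.apply_eq_smul
    simp only [ContinuousLinearMap.coe_coe] at this
    simp [this]
  · rw [spectrum.mem_resolventSet_iff, ← IsUnit.neg_iff] at h
    rw [← ContinuousLinearMap.isUnit_iff_bijective]
    convert h using 1
    simp [sub_eq_add_neg, add_comm]

/-- Apply `T - μ` repeatedly to a root vector outside `M`: the last iterate before entering `M` lies
outside `M` and is sent into it. Removing its projection on `M` keeps this property because `M` is
invariant. -/
theorem exists_unit_orthogonal_of_not_le {E : Type*} [NormedAddCommGroup E] [InnerProductSpace ℂ E]
    (T : E →ₗ[ℂ] E) (M : Submodule ℂ E)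
    [FiniteDimensional ℂ M] (hM : M ≤ M.comap T) {μ : ℂ} (h : ¬ Module.End.maxGenEigenspace T μ ≤ M) :
    ∃ y ∈ Mᗮ, ‖y‖ = 1 ∧ T y - μ • y ∈ M := by
  classical
  obtain ⟨x, hx, hxM⟩ := SetLike.not_le_iff_exists.1 h
  rw [Module.End.mem_maxGenEigenspace] at hx
  have hex : ∃ k, ((T - μ • (1 : Module.End ℂ E)) ^ k) x ∈ M := by
    obtain ⟨k, hk⟩ := hx
    exact ⟨k, hk ▸ M.zero_mem⟩
  have hk0 : Nat.find hex ≠ 0 := by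
    intro h0
    have := Nat.find_spec hex
    rw [h0] at this
    exact hxM this
  obtain ⟨k, hk⟩ := Nat.exists_eq_succ_of_ne_zero hk0
  set x' := ((T - μ • (1 : Module.End ℂ E)) ^ k) x with hx'
  have h1 : x' ∉ M := Nat.find_min hex (by omega)
  have h2 : T x' - μ • x' ∈ M := by
    have := Nat.find_spec hex
    rw [hk, pow_succ'] at this
    exact this
  set p := M.starProjection x' with hp
  have hpM : p ∈ M := by simp [hp]
  have hne : x' - p ≠ 0 := fun h => h1 (by rw [sub_eq_zero.1 h]; exact hpM)
  have hpos : 0 < ‖x' - p‖ := norm_pos_iff.2 hne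
  refine ⟨((‖x' - p‖⁻¹ : ℝ) : ℂ) • (x' - p), Mᗮ.smul_mem _ (M.sub_starProjection_mem_orthogonal x'),
    ?_, ?_⟩
  · rw [norm_smul]; simp [hpos.ne']
  · rw [map_smul, smul_comm μ, ← smul_sub]
    refine M.smul_mem _ ?_
    have : T (x' - p) - μ • (x' - p) = (T x' - μ • x') - (T p - μ • p) := by
      rw [map_sub]; module
    rw [this]
    exact M.sub_mem h2 (M.sub_mem (hM hpM) (M.smul_mem _ hpM))

/-- The root subspaces of a compact operator for eigenvalues bounded away from zero span a finite
dimensional space. -/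
theorem finiteDimensional_iSup_maxGenEigenspace {E : Type*} [NormedAddCommGroup E]
    [InnerProductSpace ℂ E] (T : E →L[ℂ] E) (hT : IsCompactOperator T)
    {r : ℝ} (hr : 0 < r) :
    FiniteDimensional ℂ (⨆ μ : {μ : ℂ // r ≤ ‖μ‖},
      Module.End.maxGenEigenspace (T : Module.End ℂ E) μ : Submodule ℂ E) := by
  by_contra hinf
  have step : ∀ M : {M : Submodule ℂ E // FiniteDimensional ℂ M ∧ M ≤ M.comap T.toLinearMap},
      ∃ y ∈ M.1ᗮ, ‖y‖ = 1 ∧ ∃ μ : ℂ, r ≤ ‖μ‖ ∧ T y - μ • y ∈ M.1 := by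
    rintro ⟨M, hMf, hMi⟩
    have : ∃ μ : {μ : ℂ // r ≤ ‖μ‖}, ¬ Module.End.maxGenEigenspace (T : Module.End ℂ E) μ ≤ M := by
      by_contra! hall
      exact hinf (Submodule.finiteDimensional_of_le (iSup_le hall))
    obtain ⟨⟨μ, hμ⟩, h⟩ := this
    obtain ⟨y, h1, h2, h3⟩ := exists_unit_orthogonal_of_not_le T.toLinearMap M hMi h
    exact ⟨y, h1, h2, μ, hμ, h3⟩
  choose y hyo hy1 μ hμ hyT using step
  have inv : ∀ M : {M : Submodule ℂ E // FiniteDimensional ℂ M ∧ M ≤ M.comap T.toLinearMap},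
      FiniteDimensional ℂ (M.1 ⊔ Submodule.span ℂ {y M} : Submodule ℂ E) ∧
      M.1 ⊔ Submodule.span ℂ {y M} ≤ (M.1 ⊔ Submodule.span ℂ {y M}).comap T.toLinearMap := by
    intro M
    have := M.2.1
    refine ⟨inferInstance, sup_le ?_ ?_⟩
    · exact M.2.2.trans (Submodule.comap_mono le_sup_left)
    · rw [Submodule.span_singleton_le_iff_mem, Submodule.mem_comap]
      have h1 : T (y M) = (T (y M) - μ M • y M) + μ M • y M := by abel
      change T (y M) ∈ _
      rw [h1]
      exact Submodule.add_mem _ (Submodule.mem_sup_left (hyT M)) (Submodule.mem_sup_right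
        (Submodule.smul_mem _ _ (Submodule.mem_span_singleton_self _)))
  -- If the span were infinite dimensional, no finite dimensional invariant subspace could contain
  -- all the root subspaces, so the chain grows forever.
  let M : ℕ → {M : Submodule ℂ E // FiniteDimensional ℂ M ∧ M ≤ M.comap T.toLinearMap} :=
    fun n => Nat.rec ⟨⊥, inferInstance, bot_le⟩ (fun _ M => ⟨_, inv M⟩) n
  have hMs : ∀ n, (M (n + 1)).1 = (M n).1 ⊔ Submodule.span ℂ {y (M n)} := fun n => rfl
  have hmono : Monotone fun n => (M n).1 := monotone_nat_of_le_succ fun n => by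
    rw [hMs]; exact le_sup_left
  have hmem : ∀ {m n}, m < n → y (M m) ∈ (M n).1 := fun {m n} h => hmono (Nat.succ_le_of_lt h) (by
    change y (M m) ∈ (M (m + 1)).1
    rw [hMs]
    exact Submodule.mem_sup_right (Submodule.mem_span_singleton_self _))
  have hsep : ∀ {m n}, m < n → r ≤ ‖T (y (M n)) - T (y (M m))‖ := by
    intro m n h
    have h1 : (T (y (M n)) - μ (M n) • y (M n)) - T (y (M m)) ∈ (M n).1 :=
      Submodule.sub_mem _ (hyT _) ((M n).2.2 (hmem h))
    -- Modulo `M n`, which is orthogonal to `y (M n)`, the difference is `μ • y (M n)`. The images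
    -- are therefore `r`-separated, contrary to compactness.
    have h2 : inner ℂ (y (M n)) (T (y (M n)) - T (y (M m))) = μ (M n) := by
      have e : T (y (M n)) - T (y (M m)) =
          ((T (y (M n)) - μ (M n) • y (M n)) - T (y (M m))) + μ (M n) • y (M n) := by abel
      rw [e, inner_add_right, Submodule.inner_left_of_mem_orthogonal h1 (hyo _), inner_smul_right,
        inner_self_eq_norm_sq_to_K, hy1]
      simp
    have h3 := norm_inner_le_norm (𝕜 := ℂ) (y (M n)) (T (y (M n)) - T (y (M m)))
    rw [h2, hy1, one_mul] at h3
    exact (hμ _).trans h3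
  obtain ⟨S, hS, hS'⟩ := hT.image_closedBall_subset_compact (f := T.toLinearMap) 1
  obtain ⟨_, -, φ, hφ, hy⟩ := hS.tendsto_subseq (x := fun n => T (y (M n)))
    (fun n => hS' ⟨y (M n), by simp [hy1], rfl⟩)
  obtain ⟨N, hN⟩ := Metric.cauchySeq_iff'.1 hy.cauchySeq r hr
  have h1 := hN (N + 1) (by omega)
  rw [dist_eq_norm] at h1
  exact absurd (hsep (hφ (Nat.lt_succ_self N))) (not_le.2 h1)

end Abstract

/-! ### Absolutely continuous primitives, test functions and constancy from a zero weak derivative.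
-/

section Primitives

open BoundedContinuousFunction

variable {a b : ℝ}

theorem _root_.AbsolutelyContinuousOnInterval.congr {X : Type*} [PseudoMetricSpace X] {f g : ℝ → X}
    (hf : AbsolutelyContinuousOnInterval f a b) (h : EqOn g f (uIcc a b)) :
    AbsolutelyContinuousOnInterval g a b := by
  refine Filter.Tendsto.congr' ?_ hf
  filter_upwards [Filter.mem_inf_of_right (Filter.mem_principal_self _)] with E hE
  refine Finset.sum_congr rfl fun i hi => ?_
  rw [h (hE.1 i hi).1, h (hE.1 i hi).2]

theorem absolutelyContinuousOnInterval_primitive {f : ℝ → ℂ} (hf : IntervalIntegrable f volume a b)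
    (c : ℂ) : AbsolutelyContinuousOnInterval (fun x => c + ∫ t in a..x, f t) a b := by
  have hconst : ∀ z : ℂ, AbsolutelyContinuousOnInterval (fun _ : ℝ => z) a b := fun z =>
    (LipschitzWith.const z).lipschitzOnWith.absolutelyContinuousOnInterval
  have hre : IntervalIntegrable (fun t => (f t).re) volume a b := ⟨hf.1.re, hf.2.re⟩
  have him : IntervalIntegrable (fun t => (f t).im) volume a b := ⟨hf.1.im, hf.2.im⟩
  have h1 := (hre.absolutelyContinuousOnInterval_intervalIntegral left_mem_uIcc).smul (hconst 1)
  have h2 := (him.absolutelyContinuousOnInterval_intervalIntegral left_mem_uIcc).smul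
    (hconst Complex.I)
  have h3 := (hconst c).add (h1.add h2)
  have hEq : EqOn (fun x => c + ∫ t in a..x, f t) ((fun _ => c) + ((fun x => ∫ t in a..x, (f t).re) •
      (fun _ => (1 : ℂ)) + (fun x => ∫ t in a..x, (f t).im) • fun _ => Complex.I)) (uIcc a b) := by
    intro x hx
    have hfx : IntervalIntegrable f volume a x :=
      hf.mono_set (uIcc_subset_uIcc left_mem_uIcc hx)
    have e1 : ∫ t in a..x, (f t).re = (∫ t in a..x, f t).re :=
      Complex.reCLM.intervalIntegral_comp_comm hfx
    have e2 : ∫ t in a..x, (f t).im = (∫ t in a..x, f t).im :=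
      Complex.imCLM.intervalIntegral_comp_comm hfx
    simp only [Pi.add_apply, Pi.smul_apply', e1, e2]
    rw [Complex.real_smul, Complex.real_smul, mul_one, Complex.re_add_im]
  exact h3.congr hEq

/-- Integration by parts for derivatives that are only integrable: `F G` minus the primitive of `f G
+ F g` is absolutely continuous with zero derivative almost everywhere, hence constant. -/
theorem integral_primitive_mul_primitive {f g : ℝ → ℂ} (hf : IntervalIntegrable f volume a b)
    (hg : IntervalIntegrable g volume a b) (c d : ℂ) :
    ∫ x in a..b, (f x * (d + ∫ t in a..x, g t) + (c + ∫ t in a..x, f t) * g x) =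
      (c + ∫ t in a..b, f t) * (d + ∫ t in a..b, g t) - c * d := by
  have hF := absolutelyContinuousOnInterval_primitive hf c
  have hG := absolutelyContinuousOnInterval_primitive hg d
  set F := fun x => c + ∫ t in a..x, f t with hFdef
  set G := fun x => d + ∫ t in a..x, g t with hGdef
  have hi : IntervalIntegrable (fun x => f x * G x + F x * g x) volume a b :=
    (hf.mul_continuousOn hG.continuousOn).add (hg.continuousOn_mul hF.continuousOn)
  have hP : AbsolutelyContinuousOnInterval (F • G - fun x => 0 + ∫ t in a..x, (f t * G t + F t * g t))
      a b := (hF.smul hG).sub (absolutelyContinuousOnInterval_primitive hi 0)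
  obtain ⟨C, hC⟩ := hP.const_of_ae_hasDerivAt_zero (by
    filter_upwards [hf.ae_hasDerivAt_integral, hg.ae_hasDerivAt_integral,
      hi.ae_hasDerivAt_integral] with x h1 h2 h3 hx
    have e1 := (h1 hx a left_mem_uIcc).const_add c
    have e2 := (h2 hx a left_mem_uIcc).const_add d
    have e3 := (h3 hx a left_mem_uIcc).const_add 0
    have := (e1.mul e2).sub e3
    rw [sub_self] at this
    exact this)
  have ha := hC a left_mem_uIcc
  have hb := hC b right_mem_uIcc
  simp only [Pi.sub_apply, smul_eq_mul, Pi.mul_apply, hFdef, hGdef,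
    intervalIntegral.integral_same, add_zero, zero_add, sub_zero] at ha hb ⊢
  rw [← ha] at hb
  linear_combination -hb

/-- A compact subset of an open interval lies in a compact subinterval. -/
theorem exists_Icc_of_isCompact (hab : a < b) {K : Set ℝ} (hK : IsCompact K) (hs : K ⊆ Ioo a b) :
    ∃ c d, a < c ∧ c ≤ d ∧ d < b ∧ K ⊆ Icc c d := by
  rcases K.eq_empty_or_nonempty with rfl | hne
  · exact ⟨(a + b) / 2, (a + b) / 2, by linarith, le_rfl, by linarith, empty_subset _⟩
  · obtain ⟨c, hc, hc'⟩ := hK.exists_isLeast hne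
    obtain ⟨d, hd, hd'⟩ := hK.exists_isGreatest hne
    exact ⟨c, d, (hs hc).1, hc' hd, (hs hd).2, fun x hx => ⟨hc' hx, hd' hx⟩⟩

theorem exists_test_integral_eq_one (hab : a < b) : ∃ φ : ℝ → ℝ, ContDiff ℝ ∞ φ ∧
    HasCompactSupport φ ∧ tsupport φ ⊆ Ioo a b ∧ ∫ x, φ x = 1 := by
  let B : ContDiffBump ((a + b) / 2) := ⟨(b - a) / 8, (b - a) / 4, by linarith, by linarith⟩
  refine ⟨B.normed volume, B.contDiff_normed, B.hasCompactSupport_normed, ?_, B.integral_normed⟩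
  rw [B.tsupport_normed_eq, Real.closedBall_eq_Icc]
  intro x hx
  have h1 := hx.1
  have h2 := hx.2
  change (a + b) / 2 - (b - a) / 4 ≤ x at h1
  change x ≤ (a + b) / 2 + (b - a) / 4 at h2
  constructor <;> linarith

/-- A test function with mean zero is the derivative of a test function. -/
theorem exists_test_primitive (hab : a < b) {χ : ℝ → ℝ} (h : ContDiff ℝ ∞ χ)
    (hc : HasCompactSupport χ) (hs : tsupport χ ⊆ Ioo a b) (h0 : ∫ x, χ x = 0) :
    ∃ φ : ℝ → ℝ, ContDiff ℝ ∞ φ ∧ HasCompactSupport φ ∧ tsupport φ ⊆ Ioo a b ∧ deriv φ = χ := by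
  obtain ⟨c, d, hac, hcd, hdb, hK⟩ := exists_Icc_of_isCompact hab hc.isCompact hs
  have hz : ∀ x, x ∉ Icc c d → χ x = 0 := fun x hx => by
    by_contra hne
    exact hx (hK (subset_tsupport _ hne))
  have hD : ∀ x, HasDerivAt (fun x => ∫ t in a..x, χ t) (χ x) x := fun x =>
    h.continuous.integral_hasStrictDerivAt a x |>.hasDerivAt
  have hder : deriv (fun x => ∫ t in a..x, χ t) = χ := funext fun x => (hD x).deriv
  -- To the left of `c` nothing has been integrated; to the right of `d` the whole integral has, and
  -- it is zero.
  have hsupp : Function.support (fun x => ∫ t in a..x, χ t) ⊆ Icc c d := by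
    intro x hx
    by_contra hnx
    refine hx ?_
    change ∫ t in a..x, χ t = 0
    rcases lt_or_ge x c with hxc | hxc
    · refine (intervalIntegral.integral_congr (g := fun _ => (0 : ℝ)) fun t ht => ?_).trans (by simp)
      refine hz t fun htc => ?_
      have : t ≤ max a x := ht.2
      have := max_lt hac hxc
      linarith [htc.1]
    · have hxd : d < x := by
        by_contra hle
        exact hnx ⟨hxc, not_lt.1 hle⟩
      rw [intervalIntegral.integral_of_le (by linarith), ← h0]
      refine setIntegral_eq_integral_of_forall_compl_eq_zero fun t ht => hz t fun htc => ht ?_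
      exact ⟨by linarith [htc.1], by linarith [htc.2]⟩
  have hts : tsupport (fun x => ∫ t in a..x, χ t) ⊆ Icc c d :=
    closure_minimal hsupp isClosed_Icc
  refine ⟨_, ?_, HasCompactSupport.of_support_subset_isCompact isCompact_Icc hsupp,
    hts.trans fun x hx => ⟨by linarith [hx.1], by linarith [hx.2]⟩, hder⟩
  rw [contDiff_infty_iff_deriv, hder]
  exact ⟨fun x => (hD x).differentiableAt, h⟩

theorem integrableOn_L2 (f : L2 a b) : IntegrableOn f (Ioo a b) :=
  (Lp.memLp f).integrable (by norm_num)

theorem intervalIntegrable_L2 (hab : a ≤ b) (f : L2 a b) {x y : ℝ} (hx : x ∈ Icc a b)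
    (hy : y ∈ Icc a b) : IntervalIntegrable f volume x y := by
  have : IntervalIntegrable f volume a b := by
    rw [intervalIntegrable_iff_integrableOn_Ioo_of_le hab]
    exact integrableOn_L2 f
  rw [← uIcc_of_le hab] at hx hy
  exact this.mono_set (uIcc_subset_uIcc hx hy)

/-- A function with vanishing generalized derivative is constant. -/
theorem IsWeakDeriv.exists_ae_eq_const (hab : a < b) {f : L2 a b} (hf : IsWeakDeriv f 0) :
    ∃ k : ℂ, f =ᵐ[volume.restrict (Ioo a b)] fun _ => k := by
  obtain ⟨φ, hφ, hφc, hφs, hφ1⟩ := exists_test_integral_eq_one hab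
  refine ⟨∫ x in Ioo a b, φ x • f x, ?_⟩
  set k := ∫ x in Ioo a b, φ x • f x with hk
  have key : ∀ᵐ x ∂(volume : Measure ℝ), x ∈ Ioo a b → f x - k = 0 := by
    refine isOpen_Ioo.ae_eq_zero_of_integral_contDiff_smul_eq_zero ?_ ?_
    · have hg : IntegrableOn (fun x => f x - k) (Ioo a b) :=
        (integrableOn_L2 f).sub (integrableOn_const (by simp))
      exact hg.locallyIntegrableOn
    · intro ψ hψ hψc hψs
      have hint : ∀ {ψ : ℝ → ℝ}, ContDiff ℝ ∞ ψ → HasCompactSupport ψ → Integrable ψ := fun h hc =>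
        h.continuous.integrable_of_hasCompactSupport hc
      -- Subtracting `(∫ ψ) φ` leaves mean zero, so the difference is the derivative of a test
      -- function and can be inserted in `hf`.
      obtain ⟨θ, hθ, hθc, hθs, hθd⟩ := exists_test_primitive hab
        (χ := fun x => ψ x - (∫ y, ψ y) * φ x) (hψ.sub (contDiff_const.mul hφ))
        (hψc.sub (hφc.mul_left))
        ((tsupport_sub _ _).trans (union_subset hψs ((tsupport_mul_subset_right).trans hφs))) (by
          rw [integral_sub (hint hψ hψc) ((hint hφ hφc).const_mul _), integral_const_mul, hφ1]
          ring)
      have h1 := hf θ hθ hθc hθs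
      have h2 : ∫ x in Ioo a b, θ x • (0 : L2 a b) x = 0 := by
        have := integral_smul_smul (a := a) (b := b) θ 0 0
        simpa only [zero_smul, zero_mul] using this
      rw [h2, hθd, neg_zero] at h1
      have i1 := integrable_smul_L2 hψ.continuous hψc f
      have i2 := integrable_smul_L2 hφ.continuous hφc f
      have h3 : (∫ x in Ioo a b, ψ x • f x) - (∫ y, ψ y) • k = 0 := by
        have i3 : Integrable (fun x => (∫ y, ψ y) • φ x • f x) (volume.restrict (Ioo a b)) :=
          i2.smul (∫ y, ψ y)
        rw [hk, ← integral_smul, ← integral_sub i1 i3, ← h1]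
        refine integral_congr_ae (Filter.Eventually.of_forall fun x => ?_)
        simp only [sub_smul, mul_smul]
      have h4 : ∫ x in Ioo a b, ψ x • (f x - k) = 0 := by
        rw [← h3]
        have : ∫ y, ψ y = ∫ y in Ioo a b, ψ y := by
          rw [setIntegral_eq_integral_of_forall_compl_eq_zero]
          intro x hx
          by_contra hne
          exact hx (hψs (subset_tsupport _ hne))
        rw [this, ← integral_smul_const, ← integral_sub i1 ((hint hψ hψc).integrableOn.smul_const k)]
        refine integral_congr_ae (Filter.Eventually.of_forall fun x => ?_)
        exact smul_sub _ _ _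
      rw [← h4, setIntegral_eq_integral_of_forall_compl_eq_zero]
      intro x hx
      have : ψ x = 0 := by
        by_contra hne
        exact hx (hψs (subset_tsupport _ hne))
      simp [this]
  filter_upwards [(ae_restrict_iff' measurableSet_Ioo).2 key] with x hx
  exact sub_eq_zero.1 hx

end Primitives

/-! ### Continuous representatives of weakly differentiable functions and Green's formula. -/

section Representatives

open BoundedContinuousFunction

variable {a b : ℝ}

/-- The extension of a continuous function on `[a, b]` by constants. -/
noncomputable def extendIcc (h : a < b) : (Icc a b →ᵇ ℂ) →L[ℂ] (ℝ →ᵇ ℂ) :=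
  LinearMap.mkContinuous
    ({ toFun := fun u => u.compContinuous ⟨projIcc a b h.le, continuous_projIcc⟩
       map_add' := fun _ _ => rfl
       map_smul' := fun _ _ => rfl } : (Icc a b →ᵇ ℂ) →ₗ[ℂ] (ℝ →ᵇ ℂ)) 1 fun u => by
      rw [one_mul]
      exact (norm_le (norm_nonneg _)).2 fun x => u.norm_coe_le_norm _

/-- The class in `L₂(a, b)` of a continuous function on `[a, b]`. -/
noncomputable def toL2 (h : a < b) : (Icc a b →ᵇ ℂ) →L[ℂ] L2 a b :=
  (BoundedContinuousFunction.toLp 2 (volume.restrict (Ioo a b)) ℂ).comp (extendIcc h)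

theorem coeFn_toL2 (h : a < b) (u : Icc a b →ᵇ ℂ) :
    toL2 h u =ᵐ[volume.restrict (Ioo a b)] IccExtend h.le u :=
  BoundedContinuousFunction.coeFn_toLp (p := 2) (μ := volume.restrict (Ioo a b)) (𝕜 := ℂ)
    (extendIcc h u)

theorem isContRep_toL2 (h : a < b) (u : Icc a b →ᵇ ℂ) :
    IsContRep (toL2 h u) (IccExtend h.le u) :=
  ⟨u.continuous.Icc_extend'.continuousOn, coeFn_toL2 h u⟩

theorem IsContRep.eqOn (h : a < b) {f : L2 a b} {u v : ℝ → ℂ} (hu : IsContRep f u)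
    (hv : IsContRep f v) : EqOn u v (Icc a b) := by
  have h1 : u =ᵐ[volume.restrict (Ioo a b)] v := hu.2.symm.trans hv.2
  have h2 : EqOn u v (Ioo a b) := Measure.eqOn_open_of_ae_eq h1 isOpen_Ioo
    (hu.1.mono Ioo_subset_Icc_self) (hv.1.mono Ioo_subset_Icc_self)
  exact h2.of_subset_closure hu.1 hv.1 Ioo_subset_Icc_self (closure_Ioo h.ne).ge

/-- Cauchy–Schwarz against the indicator of `(x, y)`. This gives the Hölder-1/2 modulus of
primitives. -/
theorem norm_integral_le_sqrt (f : L2 a b) {x y : ℝ} (hax : a ≤ x) (hxy : x ≤ y)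
    (hyb : y ≤ b) : ‖∫ t in x..y, f t‖ ≤ √(y - x) * ‖f‖ := by
  have hμ : (volume.restrict (Ioo a b)) (Ioo x y) ≠ ⊤ := measure_ne_top _ _
  have hr : (volume.restrict (Ioo a b)).restrict (Ioo x y) = volume.restrict (Ioo x y) :=
    Measure.restrict_restrict_of_subset (Ioo_subset_Ioo hax hyb)
  have h1 : ∫ t in x..y, f t = inner ℂ (indicatorConstLp 2 measurableSet_Ioo hμ (1 : ℂ)) f := by
    rw [L2.inner_indicatorConstLp_one, hr, intervalIntegral.integral_of_le hxy,
      integral_Ioc_eq_integral_Ioo]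
  have h2 : ‖indicatorConstLp 2 measurableSet_Ioo hμ (1 : ℂ)‖ = √(y - x) := by
    rw [norm_indicatorConstLp (by norm_num) (by norm_num), Measure.real,
      Measure.restrict_apply measurableSet_Ioo, inter_eq_self_of_subset_left
        (Ioo_subset_Ioo hax hyb), Real.volume_Ioo, ENNReal.toReal_ofReal (by linarith),
      Real.sqrt_eq_rpow]
    simp
  rw [h1, ← h2]
  exact norm_inner_le_norm _ _

theorem norm_integral_le_sqrt_dist (f : L2 a b) {x y : ℝ} (hx : x ∈ Icc a b)
    (hy : y ∈ Icc a b) : ‖∫ t in x..y, f t‖ ≤ √(dist x y) * ‖f‖ := by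
  rcases le_total x y with hxy | hxy
  · rw [dist_comm, Real.dist_eq, abs_of_nonneg (by linarith)]
    exact norm_integral_le_sqrt f hx.1 hxy hy.2
  · rw [intervalIntegral.integral_symm, norm_neg, Real.dist_eq, abs_of_nonneg (by linarith)]
    exact norm_integral_le_sqrt f hy.1 hxy hx.2

theorem dist_integral_le (h : a < b) (f : L2 a b) {x y : ℝ} (hx : x ∈ Icc a b) (hy : y ∈ Icc a b) :
    dist (∫ t in a..x, f t) (∫ t in a..y, f t) ≤ √(dist x y) * ‖f‖ := by
  have ha : a ∈ Icc a b := ⟨le_rfl, h.le⟩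
  rw [dist_comm x, dist_eq_norm, intervalIntegral.integral_interval_sub_left
    (intervalIntegrable_L2 h.le f ha hx) (intervalIntegrable_L2 h.le f ha hy)]
  exact norm_integral_le_sqrt_dist f hy hx

theorem intervalIntegral_congr_L2 {f : L2 a b} {g : ℝ → ℂ}
    (hfg : f =ᵐ[volume.restrict (Ioo a b)] g) {x : ℝ} (hx : x ∈ Icc a b) :
    ∫ t in a..x, f t = ∫ t in a..x, g t := by
  rw [intervalIntegral.integral_of_le hx.1, intervalIntegral.integral_of_le hx.1,
    integral_Ioc_eq_integral_Ioo, integral_Ioc_eq_integral_Ioo]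
  exact integral_congr_ae (ae_restrict_of_ae_restrict_of_subset
    (Ioo_subset_Ioo le_rfl hx.2) hfg)

theorem tendsto_sqrt_mul (C : ℝ) : Filter.Tendsto (fun r => √r * C) (𝓝 0) (𝓝 0) := by
  have : Continuous fun r : ℝ => √r * C := by fun_prop
  simpa using this.tendsto 0

/-- The primitive of an `L₂` function that vanishes at the left end point. -/
noncomputable def primitive (h : a < b) : L2 a b →L[ℂ] (Icc a b →ᵇ ℂ) :=
  LinearMap.mkContinuous
    { toFun := fun f => mkOfCompact ⟨fun x => ∫ t in a..x, f t, by
        refine continuous_iff_continuousAt.2 fun x => tendsto_iff_dist_tendsto_zero.2 ?_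
        have h1 : Filter.Tendsto (fun y : Icc a b => dist (y : ℝ) (x : ℝ)) (𝓝 x) (𝓝 0) := by
          have : Continuous fun y : Icc a b => dist (y : ℝ) (x : ℝ) := by fun_prop
          simpa using this.tendsto x
        exact squeeze_zero (fun _ => dist_nonneg) (fun y => dist_integral_le h f y.2 x.2)
          ((tendsto_sqrt_mul ‖f‖).comp h1)⟩
      map_add' := fun f g => by
        have ha : a ∈ Icc a b := ⟨le_rfl, h.le⟩
        ext x
        exact (intervalIntegral_congr_L2 (Lp.coeFn_add f g) x.2).trans
          (intervalIntegral.integral_add (intervalIntegrable_L2 h.le f ha x.2)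
            (intervalIntegrable_L2 h.le g ha x.2))
      map_smul' := fun c f => by
        ext x
        exact (intervalIntegral_congr_L2 (Lp.coeFn_smul c f) x.2).trans
          (intervalIntegral.integral_smul c _) }
    √(b - a) fun f => by
      refine (norm_le (by positivity)).2 fun x => ?_
      refine (norm_integral_le_sqrt f le_rfl x.2.1 x.2.2).trans ?_
      gcongr
      exact x.2.2

theorem primitive_apply (h : a < b) (f : L2 a b) (x : Icc a b) :
    primitive h f x = ∫ t in a..x, f t := rfl

/-- Arzelà–Ascoli: primitives of the unit ball are bounded and share the modulus `√r`. All
compactness of Sobolev embeddings and traces below comes from here. -/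
theorem isCompactOperator_primitive (h : a < b) : IsCompactOperator (primitive h) := by
  refine (isCompactOperator_iff_isCompact_closure_image_closedBall (primitive h).toLinearMap
    one_pos).2 ?_
  refine arzela_ascoli (Metric.closedBall 0 ‖primitive h‖) (isCompact_closedBall _ _) _ ?_ ?_
  · rintro _ x ⟨f, hf, rfl⟩
    rw [mem_closedBall_zero_iff] at hf ⊢
    refine (norm_coe_le_norm _ x).trans (((primitive h).le_opNorm f).trans ?_)
    exact mul_le_of_le_one_right (norm_nonneg _) hf
  · refine Metric.equicontinuous_of_continuity_modulus (fun r => √r * 1) (tendsto_sqrt_mul 1) _ ?_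
    rintro x y ⟨_, f, hf, rfl⟩
    rw [mem_closedBall_zero_iff] at hf
    refine (dist_integral_le h f x.2 y.2).trans ?_
    rw [← Subtype.dist_eq]
    gcongr

theorem integral_deriv_smul_primitive (h : a < b) (g : L2 a b) (k : ℂ) {φ : ℝ → ℝ}
    (hφ : ContDiff ℝ ∞ φ) (hs : tsupport φ ⊆ Ioo a b) :
    ∫ x in a..b, (((deriv φ x : ℝ) : ℂ) * (k + ∫ t in a..x, g t) + (φ x : ℂ) * g x) = 0 := by
  have hz : ∀ x, x ∉ Ioo a b → φ x = 0 := fun x hx => by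
    by_contra hne
    exact hx (hs (subset_tsupport _ hne))
  have hcd : Continuous fun x => ((deriv φ x : ℝ) : ℂ) :=
    Complex.continuous_ofReal.comp (hφ.continuous_deriv (by simp))
  have hft : ∀ x, ((0 : ℂ) + ∫ t in a..x, ((deriv φ t : ℝ) : ℂ)) = φ x := fun x => by
    rw [intervalIntegral.integral_ofReal, intervalIntegral.integral_deriv_eq_sub
      (fun y _ => hφ.differentiable (by simp) y)
      ((hφ.continuous_deriv (by simp)).intervalIntegrable _ _), hz a (by simp)]
    simp
  have := integral_primitive_mul_primitive (hcd.intervalIntegrable a b)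
    (intervalIntegrable_L2 h.le g (left_mem_Icc.2 h.le) (right_mem_Icc.2 h.le)) 0 k
  simp only [hft] at this
  rw [this, hz b (by simp)]
  simp

theorem isWeakDeriv_toL2 (h : a < b) (g : L2 a b) (k : ℂ) :
    IsWeakDeriv (toL2 h (primitive h g + const _ k)) g := by
  intro φ hφ hc hs
  rw [eq_neg_iff_add_eq_zero, ← integral_add
    (integrable_smul_L2 (hφ.continuous_deriv (by simp)) hc.deriv _)
    (integrable_smul_L2 hφ.continuous hc g),
    ← integral_deriv_smul_primitive h g k hφ hs, intervalIntegral.integral_of_le h.le,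
    integral_Ioc_eq_integral_Ioo]
  refine integral_congr_ae ?_
  filter_upwards [coeFn_toL2 h (primitive h g + const _ k),
    ae_restrict_mem measurableSet_Ioo] with x hx hxI
  rw [hx, IccExtend_of_mem _ _ (Ioo_subset_Icc_self hxI), Complex.real_smul, Complex.real_smul]
  simp only [coe_add, Pi.add_apply, primitive_apply, const_apply]
  ring

/-- Elements of `W₂¹` are primitives of their generalized derivatives. -/
theorem IsWeakDeriv.exists_eq (h : a < b) {f g : L2 a b} (hfg : IsWeakDeriv f g) :
    ∃ k : ℂ, f = toL2 h (primitive h g) + k • toL2 h (const _ 1) := by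
  have h1 : IsWeakDeriv (f - toL2 h (primitive h g + const _ 0)) 0 := by
    have := hfg.add ((isWeakDeriv_toL2 h g 0).smul (-1))
    convert this using 1
    · module
    · module
  obtain ⟨k, hk⟩ := h1.exists_ae_eq_const h
  refine ⟨k, ?_⟩
  have h2 : f - toL2 h (primitive h g + const _ 0) = toL2 h (const _ k) := by
    refine Lp.ext (hk.trans ?_)
    filter_upwards [coeFn_toL2 h (const _ k)] with x hx
    rw [hx]; rfl
  have h3 : k • toL2 h (const _ (1 : ℂ)) = toL2 h (const _ k) := by
    rw [← map_smul]; congr 1; ext x; simp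
  rw [h3, ← h2]
  have h4 : primitive h g + const _ (0 : ℂ) = primitive h g := by ext; simp
  rw [h4]; abel

theorem toL2_injective (h : a < b) : Function.Injective (toL2 h) := by
  intro u v huv
  have h1 := (isContRep_toL2 h u).eqOn h (huv ▸ isContRep_toL2 h v)
  ext x
  simpa [IccExtend_of_mem _ _ x.2] using h1 x.2

theorem toL2_one_ne_zero (h : a < b) : toL2 h (const _ 1) ≠ 0 := by
  intro h0
  rw [← map_zero (toL2 h)] at h0
  have := congrArg (fun u : Icc a b →ᵇ ℂ => u ⟨a, left_mem_Icc.2 h.le⟩) (toL2_injective h h0)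
  simp at this

/-- The mean value of an `L₂` function. -/
noncomputable def meanValue (h : a < b) : L2 a b →L[ℂ] ℂ :=
  ((‖toL2 h (const _ 1)‖ ^ 2 : ℝ) : ℂ)⁻¹ • innerSL ℂ (toL2 h (const _ 1))

theorem meanValue_one (h : a < b) : meanValue h (toL2 h (const _ 1)) = 1 := by
  have : (‖toL2 h (const _ 1)‖ : ℂ) ≠ 0 := by exact_mod_cast norm_ne_zero_iff.2 (toL2_one_ne_zero h)
  simp only [meanValue, FunLike.coe_smul, Pi.smul_apply, innerSL_apply_apply, smul_eq_mul]
  rw [inner_self_eq_norm_sq_to_K]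
  push_cast
  exact inv_mul_cancel₀ (pow_ne_zero 2 this)

/-- The continuous representative of `f`, given `f` and its generalized derivative. -/
noncomputable def contRep (h : a < b) : L2 a b × L2 a b →L[ℂ] (Icc a b →ᵇ ℂ) :=
  (primitive h).comp (ContinuousLinearMap.snd ℂ _ _) +
    ((meanValue h).comp (ContinuousLinearMap.fst ℂ _ _ -
      ((toL2 h).comp (primitive h)).comp (ContinuousLinearMap.snd ℂ _ _))).smulRight (const _ 1)

theorem exists_contRep_eq (h : a < b) (f g : L2 a b) :
    ∃ k : ℂ, contRep h (f, g) = primitive h g + const _ k := by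
  refine ⟨meanValue h (f - toL2 h (primitive h g)), ?_⟩
  ext x
  simp [contRep]

theorem isCompactOperator_contRep (h : a < b) : IsCompactOperator (contRep h) := by
  refine IsCompactOperator.add ((isCompactOperator_primitive h).comp_clm _) ?_
  have : IsCompactOperator (ContinuousLinearMap.smulRight (1 : ℂ →L[ℂ] ℂ)
      (const (Icc a b) (1 : ℂ))) :=
    isCompactOperator_of_locallyCompactSpace_rng _
  exact this.comp_clm ((meanValue h).comp (ContinuousLinearMap.fst ℂ _ _ -
      ((toL2 h).comp (primitive h)).comp (ContinuousLinearMap.snd ℂ _ _)))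

/-- `contRep` is defined for every pair `(f, g)`, fixing the constant of integration by the mean of
`f`. Being a weak derivative thus becomes a closed linear equation, which yields completeness of
`Sob` and bounded evaluation at points. -/
theorem isWeakDeriv_iff (h : a < b) {f g : L2 a b} :
    IsWeakDeriv f g ↔ toL2 h (contRep h (f, g)) = f := by
  constructor
  · intro hfg
    obtain ⟨k, hk⟩ := hfg.exists_eq h
    have h1 : f - toL2 h (primitive h g) = k • toL2 h (const _ 1) := by
      rw [sub_eq_iff_eq_add']; exact hk
    have h2 : contRep h (f, g) = primitive h g + k • const _ 1 := by
      have : contRep h (f, g) = primitive h g +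
        meanValue h (f - toL2 h (primitive h g)) • const _ 1 := rfl
      rw [this, h1, map_smul, meanValue_one, smul_eq_mul, mul_one]
    rw [h2, map_add, map_smul, ← hk]
  · intro hfg
    obtain ⟨k, hk⟩ := exists_contRep_eq h f g
    rw [← hfg, hk]
    exact isWeakDeriv_toL2 h g k

theorem contRep_primitive (h : a < b) (g : L2 a b) (k : ℂ) :
    contRep h (toL2 h (primitive h g + const _ k), g) = primitive h g + const _ k :=
  toL2_injective h ((isWeakDeriv_iff h).1 (isWeakDeriv_toL2 h g k))

theorem IsWeakDeriv.isContRep (h : a < b) {f g : L2 a b} (hfg : IsWeakDeriv f g) :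
    IsContRep f (IccExtend h.le (contRep h (f, g))) := by
  conv_lhs => rw [← (isWeakDeriv_iff h).1 hfg]
  exact isContRep_toL2 h _

/-- Green's formula. -/
theorem IsWeakDeriv.inner_eq (h : a < b) {f₀ f₁ f₂ : L2 a b} (h01 : IsWeakDeriv f₀ f₁)
    (h12 : IsWeakDeriv f₁ f₂) :
    inner ℂ f₀ f₂ =
      starRingEnd ℂ (contRep h (f₀, f₁) ⟨b, right_mem_Icc.2 h.le⟩) *
          contRep h (f₁, f₂) ⟨b, right_mem_Icc.2 h.le⟩ -
        starRingEnd ℂ (contRep h (f₀, f₁) ⟨a, left_mem_Icc.2 h.le⟩) *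
          contRep h (f₁, f₂) ⟨a, left_mem_Icc.2 h.le⟩ - ((‖f₁‖ ^ 2 : ℝ) : ℂ) := by
  obtain ⟨k, hk⟩ := exists_contRep_eq h f₀ f₁
  obtain ⟨l, hl⟩ := exists_contRep_eq h f₁ f₂
  have ha := left_mem_Icc.2 h.le
  have hb := right_mem_Icc.2 h.le
  have e0 := (h01.isContRep h).2
  have e1 := (h12.isContRep h).2
  rw [hk] at e0
  rw [hl] at e1
  have i1 := intervalIntegrable_L2 h.le f₁ ha hb
  have i1' : IntervalIntegrable (fun x => starRingEnd ℂ (f₁ x)) volume a b := by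
    have : Integrable (fun x => starRingEnd ℂ (f₁ x)) (volume.restrict (Ioo a b)) :=
      (integrable_norm_iff (Complex.continuous_conj.comp_aestronglyMeasurable
        (Lp.aestronglyMeasurable f₁))).1 (by simpa using (integrableOn_L2 f₁).norm)
    rw [intervalIntegrable_iff_integrableOn_Ioo_of_le h.le]
    exact this
  have i2 := intervalIntegrable_L2 h.le f₂ ha hb
  have hconj : ∀ x, ∫ t in a..x, starRingEnd ℂ (f₁ t) = starRingEnd ℂ (∫ t in a..x, f₁ t) := by
    intro x
    rw [intervalIntegral.intervalIntegral_eq_integral_uIoc,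
      intervalIntegral.intervalIntegral_eq_integral_uIoc,
      integral_conj]
    split_ifs <;> simp
  -- Integration by parts for `conj f₀`, as a primitive of `conj f₁`, against `f₁`, as a primitive
  -- of `f₂`.
  have main := integral_primitive_mul_primitive i1' i2 (starRingEnd ℂ k) l
  have s : inner ℂ f₁ f₁ + inner ℂ f₀ f₂ = ∫ x in a..b, (starRingEnd ℂ (f₁ x) *
      (l + ∫ t in a..x, f₂ t) + (starRingEnd ℂ k + ∫ t in a..x, starRingEnd ℂ (f₁ t)) * f₂ x) := by
    rw [L2.inner_def, L2.inner_def, ← integral_add (L2.integrable_inner f₁ f₁)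
      (L2.integrable_inner f₀ f₂), intervalIntegral.integral_of_le h.le,
      integral_Ioc_eq_integral_Ioo]
    refine integral_congr_ae ?_
    filter_upwards [e0, e1, ae_restrict_mem measurableSet_Ioo] with x hx0 hx1 hxI
    have hxI' := Ioo_subset_Icc_self hxI
    rw [IccExtend_of_mem _ _ hxI'] at hx0 hx1
    simp only [coe_add, Pi.add_apply, primitive_apply, const_apply] at hx0 hx1
    rw [hconj, ← map_add, add_comm k, ← hx0, add_comm l, ← hx1]
    simp only [RCLike.inner_apply]
    ring
  rw [← s, hconj, inner_self_eq_norm_sq_to_K] at main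
  rw [hk, hl]
  simp only [coe_add, Pi.add_apply, primitive_apply, const_apply, intervalIntegral.integral_same,
    zero_add, map_add]
  rw [eq_sub_iff_add_eq, add_comm]
  push_cast
  refine Eq.trans main ?_
  ring

end Representatives

/-! ### Sobolev spaces on one interval: completeness, traces, initial value problem. -/

section Sobolev

open BoundedContinuousFunction

variable {a b : ℝ} {n : ℕ}

/-- `Sob.der` as a bounded operator. -/
noncomputable def Sob.derL (k : Fin (n + 1)) : Sob n a b →L[ℂ] L2 a b :=
  (PiLp.proj 2 (fun _ : Fin (n + 1) => L2 a b) k).comp (Sob n a b).subtypeL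

theorem Sob.norm_sq_eq (w : Sob n a b) : ‖w‖ ^ 2 = ∑ k, ‖Sob.der k w‖ ^ 2 :=
  PiLp.norm_sq_eq_of_L2 _ w.1

theorem Sob.isClosed (h : a < b) :
    IsClosed (Sob n a b : Set (PiLp 2 (fun _ : Fin (n + 1) => L2 a b))) := by
  have : (Sob n a b : Set (PiLp 2 (fun _ : Fin (n + 1) => L2 a b))) =
      ⋂ k : Fin n, {w | toL2 h (contRep h (w k.castSucc, w k.succ)) = w k.castSucc} := by
    ext w
    simp only [mem_iInter]
    exact forall_congr' fun k => isWeakDeriv_iff h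
  rw [this]
  have hc : ∀ k, Continuous fun w : PiLp 2 (fun _ : Fin (n + 1) => L2 a b) => w k := fun k =>
    (PiLp.proj (𝕜 := ℂ) 2 (fun _ : Fin (n + 1) => L2 a b) k).continuous
  exact isClosed_iInter fun k => isClosed_eq (((toL2 h).comp (contRep h)).continuous.comp
    ((hc _).prodMk (hc _))) (hc _)

theorem Sob.completeSpace (h : a < b) : CompleteSpace (Sob n a b) :=
  (Sob.isClosed h).completeSpace_coe

/-- The continuous representative of the `k`-th generalized derivative. -/
noncomputable def Sob.rep (h : a < b) (k : Fin n) : Sob n a b →L[ℂ] (Icc a b →ᵇ ℂ) :=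
  (contRep h).comp ((Sob.derL k.castSucc).prod (Sob.derL k.succ))

theorem Sob.toL2_rep (h : a < b) (k : Fin n) (w : Sob n a b) :
    toL2 h (Sob.rep h k w) = Sob.der k.castSucc w :=
  (isWeakDeriv_iff h).1 (w.2 k)

theorem Sob.isContRep_rep (h : a < b) (k : Fin n) (w : Sob n a b) :
    IsContRep (Sob.der k.castSucc w) (IccExtend h.le (Sob.rep h k w)) :=
  (w.2 k).isContRep h

theorem Sob.isCompactOperator_rep (h : a < b) (k : Fin n) : IsCompactOperator (Sob.rep h k) :=
  (isCompactOperator_contRep h).comp_clm _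

theorem Sob.isCompactOperator_derL (h : a < b) (k : Fin n) :
    IsCompactOperator (Sob.derL k.castSucc : Sob n a b →L[ℂ] L2 a b) := by
  have e : ⇑(Sob.derL k.castSucc : Sob n a b →L[ℂ] L2 a b) = ⇑(toL2 h) ∘ ⇑(Sob.rep h k) :=
    funext fun w => (Sob.toL2_rep h k w).symm
  rw [e]
  exact (Sob.isCompactOperator_rep h k).clm_comp (toL2 h)

theorem Sob.rep_eq_zero (h : a < b) {k : Fin n} {w : Sob n a b} (h1 : Sob.der k.succ w = 0)
    (h2 : Sob.rep h k w ⟨a, left_mem_Icc.2 h.le⟩ = 0) : Sob.der k.castSucc w = 0 := by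
  rw [← Sob.toL2_rep h]
  obtain ⟨z, hz⟩ := exists_contRep_eq h (Sob.der k.castSucc w) (Sob.der k.succ w)
  rw [h1, map_zero, zero_add] at hz
  have h3 : Sob.rep h k w = const _ z := by
    rw [← hz, ← h1]; rfl
  rw [h3] at h2 ⊢
  have hz0 : z = 0 := h2
  rw [hz0]
  exact map_zero (toL2 h)

/-- A `W₂²` function vanishes if its second derivative and its initial data vanish. -/
theorem Sob.eq_zero (h : a < b) {w : Sob 2 a b} (h2 : Sob.der 2 w = 0)
    (h1 : Sob.rep h 1 w ⟨a, left_mem_Icc.2 h.le⟩ = 0)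
    (h0 : Sob.rep h 0 w ⟨a, left_mem_Icc.2 h.le⟩ = 0) : w = 0 := by
  have e1 : Sob.der 1 w = 0 := Sob.rep_eq_zero h (k := 1) h2 h1
  have e0 : Sob.der 0 w = 0 := Sob.rep_eq_zero h (k := 0) e1 h0
  exact Sob.toL2_injective (e0.trans (map_zero _).symm)

/-- The initial value problem `w'' = g` is solvable in `W₂²`. -/
theorem Sob.exists_der_two_eq (h : a < b) (g : L2 a b) (c₀ c₁ : ℂ) : ∃ w : Sob 2 a b,
    Sob.der 2 w = g ∧ Sob.rep h 0 w ⟨a, left_mem_Icc.2 h.le⟩ = c₀ ∧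
      Sob.rep h 1 w ⟨a, left_mem_Icc.2 h.le⟩ = c₁ := by
  set f₁ := toL2 h (primitive h g + const _ c₁) with hf₁
  set f₀ := toL2 h (primitive h f₁ + const _ c₀) with hf₀
  refine ⟨⟨WithLp.toLp 2 ![f₀, f₁, g], ?_⟩, rfl, ?_, ?_⟩
  · intro k
    fin_cases k
    · exact isWeakDeriv_toL2 h f₁ c₀
    · exact isWeakDeriv_toL2 h g c₁
  · change contRep h (f₀, f₁) _ = _
    rw [hf₀, contRep_primitive]
    simp [primitive_apply]
  · change contRep h (f₁, g) _ = _
    rw [hf₁, contRep_primitive]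
    simp [primitive_apply]

theorem Sob.inner_der_two (h : a < b) (w : Sob 2 a b) :
    inner ℂ (Sob.der 0 w) (Sob.der 2 w) =
      starRingEnd ℂ (Sob.rep h 0 w ⟨b, right_mem_Icc.2 h.le⟩) *
          Sob.rep h 1 w ⟨b, right_mem_Icc.2 h.le⟩ -
        starRingEnd ℂ (Sob.rep h 0 w ⟨a, left_mem_Icc.2 h.le⟩) *
          Sob.rep h 1 w ⟨a, left_mem_Icc.2 h.le⟩ - ((‖Sob.der 1 w‖ ^ 2 : ℝ) : ℂ) :=
  IsWeakDeriv.inner_eq h (w.2 0) (w.2 1)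

/-- Trace inequality with a small constant in front of the derivative. -/
theorem Sob.exists_norm_rep_sq_le (h : a < b) (x : Icc a b) {δ : ℝ} (hδ : 0 < δ) :
    ∃ C : ℝ, 0 < C ∧ ∀ w : Sob 2 a b,
      ‖Sob.rep h 0 w x‖ ^ 2 ≤ δ * ‖Sob.der 1 w‖ ^ 2 + C * ‖Sob.der 0 w‖ ^ 2 := by
  have := Sob.completeSpace (n := 1) h
  obtain ⟨C, hC, hle⟩ := exists_norm_le_of_isCompactOperator (Sob.derL 0 : Sob 1 a b →L[ℂ] L2 a b)
    Sob.toL2_injective ((evalCLM ℂ x).comp (Sob.rep h 0))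
    ((Sob.isCompactOperator_rep h 0).clm_comp (evalCLM ℂ x)) (δ := √(δ / 2)) (by positivity)
  refine ⟨δ + 2 * C ^ 2, by positivity, fun w => ?_⟩
  -- Forgetting the second derivative keeps `u''` out of the bound: Ehrling's inequality is applied
  -- in `W₂¹`. The choice `√(δ / 2)` pays for `(x + y)² ≤ 2 x² + 2 y²`.
  let v : Sob 1 a b := ⟨WithLp.toLp 2 ![Sob.der 0 w, Sob.der 1 w], fun k => by
    fin_cases k; exact w.2 0⟩
  have h1 := hle v
  have h2 : ‖v‖ ^ 2 = ‖Sob.der 0 w‖ ^ 2 + ‖Sob.der 1 w‖ ^ 2 := by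
    rw [Sob.norm_sq_eq, Fin.sum_univ_two]; rfl
  change ‖Sob.rep h 0 w x‖ ≤ √(δ / 2) * ‖v‖ + C * ‖Sob.der 0 w‖ at h1
  have h3 := Real.sq_sqrt (show 0 ≤ δ / 2 by positivity)
  calc _ ≤ (√(δ / 2) * ‖v‖ + C * ‖Sob.der 0 w‖) ^ 2 := by gcongr
    _ ≤ 2 * (√(δ / 2) * ‖v‖) ^ 2 + 2 * (C * ‖Sob.der 0 w‖) ^ 2 := by
      linarith [sq_nonneg (√(δ / 2) * ‖v‖ - C * ‖Sob.der 0 w‖)]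
    _ = _ := by
      rw [mul_pow, mul_pow, h3, h2]; ring

end Sobolev

/-! ### The two-interval spaces, boundary forms and Fredholm solvability. -/

section Operators

open BoundedContinuousFunction

theorem left_lt : (-1 : ℝ) < 0 := by norm_num

theorem right_lt : (0 : ℝ) < 1 := one_pos

instance (n : ℕ) : CompleteSpace (W n) :=
  have := Sob.completeSpace (n := n) left_lt
  have := Sob.completeSpace (n := n) right_lt
  inferInstance

/-- The restriction of an element of `W n` to the left interval. -/
noncomputable def fstW (n : ℕ) : W n →L[ℂ] Sob n (-1) 0 :=
  WithLp.fstL 2 ℂ _ _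

/-- The restriction of an element of `W n` to the right interval. -/
noncomputable def sndW (n : ℕ) : W n →L[ℂ] Sob n 0 1 :=
  WithLp.sndL 2 ℂ _ _

/-- Pairing of operators with values in the two components of `H`. -/
noncomputable def pairH {E : Type*} [NormedAddCommGroup E] [NormedSpace ℂ E] (S : E →L[ℂ] L2 (-1) 0)
    (T : E →L[ℂ] L2 0 1) : E →L[ℂ] H :=
  (WithLp.prodContinuousLinearEquiv 2 ℂ (L2 (-1) 0) (L2 0 1)).symm.toContinuousLinearMap.comp
    (S.prod T)

theorem _root_.IsCompactOperator.prod_clm {E F G : Type*} [NormedAddCommGroup E] [NormedSpace ℂ E]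
    [NormedAddCommGroup F] [NormedSpace ℂ F] [NormedAddCommGroup G] [NormedSpace ℂ G]
    {S : E →L[ℂ] F} {T : E →L[ℂ] G} (hS : IsCompactOperator S) (hT : IsCompactOperator T) :
    IsCompactOperator (S.prod T) := by
  have e : ⇑(S.prod T) = ⇑(ContinuousLinearMap.inl ℂ F G) ∘ ⇑S +
      ⇑(ContinuousLinearMap.inr ℂ F G) ∘ ⇑T := by
    ext1 x
    simp
  rw [e]
  exact (hS.clm_comp (ContinuousLinearMap.inl ℂ F G)).add
    (hT.clm_comp (ContinuousLinearMap.inr ℂ F G))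

theorem _root_.IsCompactOperator.pairH {E : Type*} [NormedAddCommGroup E] [NormedSpace ℂ E]
    {S : E →L[ℂ] L2 (-1) 0} {T : E →L[ℂ] L2 0 1} (hS : IsCompactOperator S)
    (hT : IsCompactOperator T) : IsCompactOperator (pairH S T) :=
  (hS.prod_clm hT).clm_comp
    (WithLp.prodContinuousLinearEquiv 2 ℂ (L2 (-1) 0) (L2 0 1)).symm.toContinuousLinearMap

/-- `emb` as a bounded operator. -/
noncomputable def embL (n : ℕ) : W n →L[ℂ] H :=
  pairH ((Sob.derL 0).comp (fstW n)) ((Sob.derL 0).comp (sndW n))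

theorem isCompactOperator_embL : IsCompactOperator (embL 2) := by
  have h1 : IsCompactOperator ((Sob.derL 0).comp (fstW 2)) :=
    (Sob.isCompactOperator_derL left_lt (0 : Fin 2)).comp_clm (fstW 2)
  have h2 : IsCompactOperator ((Sob.derL 0).comp (sndW 2)) :=
    (Sob.isCompactOperator_derL right_lt (0 : Fin 2)).comp_clm (sndW 2)
  exact h1.pairH h2

/-- `diffExpr` as a bounded operator. -/
noncomputable def diffExprL (c : Coeffs) : W 2 →L[ℂ] H :=
  pairH ((c.p₁ : ℂ) • (Sob.derL 2).comp (fstW 2)) ((c.p₂ : ℂ) • (Sob.derL 2).comp (sndW 2))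

/-- Boundary values: `k`-th derivative on the left interval. -/
noncomputable def valL (k : Fin 2) (x : Icc (-1 : ℝ) 0) : W 2 →L[ℂ] ℂ :=
  ((evalCLM ℂ x).comp (Sob.rep left_lt k)).comp (fstW 2)

/-- Boundary values: `k`-th derivative on the right interval. -/
noncomputable def valR (k : Fin 2) (x : Icc (0 : ℝ) 1) : W 2 →L[ℂ] ℂ :=
  ((evalCLM ℂ x).comp (Sob.rep right_lt k)).comp (sndW 2)

/-- The end points of the two intervals. -/
def leftA : Icc (-1 : ℝ) 0 := ⟨-1, left_mem_Icc.2 left_lt.le⟩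
def leftB : Icc (-1 : ℝ) 0 := ⟨0, right_mem_Icc.2 left_lt.le⟩
def rightA : Icc (0 : ℝ) 1 := ⟨0, left_mem_Icc.2 right_lt.le⟩
def rightB : Icc (0 : ℝ) 1 := ⟨1, right_mem_Icc.2 right_lt.le⟩

/-- The boundary and transmission forms. -/
noncomputable def bcMap (c : Coeffs) : W 2 →L[ℂ] (ℂ × ℂ) × (ℂ × ℂ) :=
  (((c.α₀ : ℂ) • valL 0 leftA + (c.α₁ : ℂ) • valL 1 leftA).prod
    ((c.β₀ : ℂ) • valR 0 rightB + (c.β₁ : ℂ) • valR 1 rightB)).prod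
  ((valL 1 leftB - (c.γ₀ : ℂ) • valL 0 leftB - (c.δ₀ : ℂ) • valR 0 rightA).prod
    (valR 1 rightA - (c.γ₁ : ℂ) • valL 0 leftB - (c.δ₁ : ℂ) • valR 0 rightA))

theorem bcMap_eq_zero_iff (c : Coeffs) (w : W 2) : bcMap c w = 0 ↔
    (c.α₀ * valL 0 leftA w + c.α₁ * valL 1 leftA w = 0 ∧
      c.β₀ * valR 0 rightB w + c.β₁ * valR 1 rightB w = 0) ∧
    valL 1 leftB w - c.γ₀ * valL 0 leftB w - c.δ₀ * valR 0 rightA w = 0 ∧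
    valR 1 rightA w - c.γ₁ * valL 0 leftB w - c.δ₁ * valR 0 rightA w = 0 := by
  rw [Prod.ext_iff, Prod.ext_iff, Prod.ext_iff]
  rfl

/-- Continuous representatives are unique on the closed interval, so the existential conditions
amount to the kernel of a bounded map. -/
theorem mem_bcSpace_iff (c : Coeffs) (w : W 2) : w ∈ bcSpace c ↔ bcMap c w = 0 := by
  rw [bcMap_eq_zero_iff]
  have r1 := Sob.isContRep_rep left_lt 0 w.fst
  have r2 := Sob.isContRep_rep left_lt 1 w.fst
  have r3 := Sob.isContRep_rep right_lt 0 w.snd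
  have r4 := Sob.isContRep_rep right_lt 1 w.snd
  have eL : ∀ (k : Fin 2) (x : Icc (-1 : ℝ) 0),
      IccExtend left_lt.le (Sob.rep left_lt k w.fst) x = valL k x w := fun k x =>
    IccExtend_of_mem _ _ x.2
  have eR : ∀ (k : Fin 2) (x : Icc (0 : ℝ) 1),
      IccExtend right_lt.le (Sob.rep right_lt k w.snd) x = valR k x w := fun k x =>
    IccExtend_of_mem _ _ x.2
  constructor
  · rintro ⟨u₁, v₁, u₂, v₂, h1, h2, h3, h4, e1, e2, e3, e4⟩
    have g1 : ∀ x : Icc (-1 : ℝ) 0, u₁ x = valL 0 x w := fun x =>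
      (h1.eqOn left_lt r1 x.2).trans (eL 0 x)
    have g2 : ∀ x : Icc (-1 : ℝ) 0, v₁ x = valL 1 x w := fun x =>
      (h2.eqOn left_lt r2 x.2).trans (eL 1 x)
    have g3 : ∀ x : Icc (0 : ℝ) 1, u₂ x = valR 0 x w := fun x =>
      (h3.eqOn right_lt r3 x.2).trans (eR 0 x)
    have g4 : ∀ x : Icc (0 : ℝ) 1, v₂ x = valR 1 x w := fun x =>
      (h4.eqOn right_lt r4 x.2).trans (eR 1 x)
    rw [← g1, ← g1, ← g2, ← g2, ← g3, ← g3, ← g4, ← g4]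
    exact ⟨⟨e1, e2⟩, e3, e4⟩
  · rintro ⟨⟨e1, e2⟩, e3, e4⟩
    rw [← eL, ← eL] at e1
    rw [← eR, ← eR] at e2
    rw [← eL, ← eL, ← eR] at e3
    rw [← eR, ← eL, ← eR] at e4
    exact ⟨_, _, _, _, r1, r2, r3, r4, e1, e2, e3, e4⟩

/-- The differential expression together with the initial data at the left end points. -/
noncomputable def initMap (c : Coeffs) : W 2 →L[ℂ] H × ((ℂ × ℂ) × (ℂ × ℂ)) :=
  (diffExprL c).prod
    (((valL 0 leftA).prod (valL 1 leftA)).prod ((valR 0 rightA).prod (valR 1 rightA)))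

/-- The two intervals decouple, and each carries an initial value problem solved by integrating
twice. This is the invertible reference operator for the Fredholm argument. -/
theorem bijective_initMap {c : Coeffs} (hp₁ : c.p₁ ≠ 0) (hp₂ : c.p₂ ≠ 0) :
    Function.Bijective (initMap c) := by
  have q₁ : (c.p₁ : ℂ) ≠ 0 := by exact_mod_cast hp₁
  have q₂ : (c.p₂ : ℂ) ≠ 0 := by exact_mod_cast hp₂
  constructor
  · rw [injective_iff_map_eq_zero]
    intro w hw
    obtain ⟨h1, h2⟩ := Prod.ext_iff.1 hw
    obtain ⟨h2, h3⟩ := Prod.ext_iff.1 h2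
    obtain ⟨a1, a2⟩ := Prod.ext_iff.1 h2
    obtain ⟨b1, b2⟩ := Prod.ext_iff.1 h3
    have d1 : (c.p₁ : ℂ) • Sob.der 2 w.fst = 0 := congrArg (fun f : H => f.fst) h1
    have d2 : (c.p₂ : ℂ) • Sob.der 2 w.snd = 0 := congrArg (fun f : H => f.snd) h1
    have e1 := Sob.eq_zero left_lt ((smul_eq_zero_iff_right q₁).1 d1) a2 a1
    have e2 := Sob.eq_zero right_lt ((smul_eq_zero_iff_right q₂).1 d2) b2 b1
    exact WithLp.ofLp_injective 2 (Prod.ext e1 e2)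
  · rintro ⟨f, ⟨a1, a2⟩, ⟨b1, b2⟩⟩
    obtain ⟨w₁, h1, h2, h3⟩ := Sob.exists_der_two_eq left_lt ((c.p₁ : ℂ)⁻¹ • f.fst) a1 a2
    obtain ⟨w₂, g1, g2, g3⟩ := Sob.exists_der_two_eq right_lt ((c.p₂ : ℂ)⁻¹ • f.snd) b1 b2
    refine ⟨WithLp.toLp 2 (w₁, w₂), Prod.ext ?_ (Prod.ext (Prod.ext h2 h3) (Prod.ext g2 g3))⟩
    refine WithLp.ofLp_injective 2 (Prod.ext ?_ ?_)
    · change (c.p₁ : ℂ) • Sob.der 2 w₁ = f.fst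
      rw [h1, smul_inv_smul₀ q₁]
    · change (c.p₂ : ℂ) • Sob.der 2 w₂ = f.snd
      rw [g1, smul_inv_smul₀ q₂]

/-- The boundary value problem `p u'' + K u = f` with homogeneous boundary conditions, where `K`
is compact, is uniquely solvable if the homogeneous problem has only the zero solution. -/
theorem exists_solution_operator {c : Coeffs} (hp₁ : c.p₁ ≠ 0) (hp₂ : c.p₂ ≠ 0) (K : W 2 →L[ℂ] H)
    (hK : IsCompactOperator K) (hinj : ∀ w ∈ bcSpace c, diffExprL c w + K w = 0 → w = 0) :
    ∃ S : H →L[ℂ] W 2, (∀ f, S f ∈ bcSpace c ∧ diffExprL c (S f) + K (S f) = f) ∧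
      ∀ w ∈ bcSpace c, S (diffExprL c w + K w) = w := by
  have hb := bijective_initMap hp₁ hp₂
  let Θ := ContinuousLinearEquiv.ofBijective (initMap c) (LinearMap.ker_eq_bot.2 hb.1)
    (LinearMap.range_eq_top.2 hb.2)
  have hΘ : ∀ w, Θ w = initMap c w := fun _ => rfl
  let Φ : W 2 →L[ℂ] H × ((ℂ × ℂ) × (ℂ × ℂ)) := (diffExprL c + K).prod (bcMap c)
  -- The correction from `initMap` to `Φ`. Its second component exchanges initial data for boundary
  -- forms and is compact because its range is finite dimensional.
  let P : W 2 →L[ℂ] H × ((ℂ × ℂ) × (ℂ × ℂ)) :=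
    K.prod (bcMap c - (ContinuousLinearMap.snd ℂ _ _).comp (initMap c))
  have hP : IsCompactOperator P :=
    hK.prod_clm (isCompactOperator_of_locallyCompactSpace_dom _)
  let Q : H × ((ℂ × ℂ) × (ℂ × ℂ)) →L[ℂ] H × ((ℂ × ℂ) × (ℂ × ℂ)) :=
    P.comp Θ.symm.toContinuousLinearMap
  have hΦ : ∀ w, Φ w = (1 + Q) (Θ w) := by
    intro w
    have : (1 + Q) (Θ w) = Θ w + P w := by
      simp [Q]
    rw [this, hΘ]
    refine Prod.ext rfl ?_
    change bcMap c w = (initMap c w).2 + (bcMap c w - (initMap c w).2)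
    abel
  have hker : ∀ w, Φ w = 0 → w = 0 := fun w hw =>
    hinj w ((mem_bcSpace_iff c w).2 (congrArg Prod.snd hw)) (congrArg Prod.fst hw)
  have hbij : Function.Bijective Φ := by
    have h1 := bijective_one_add_of_isCompactOperator Q (hP.comp_clm _) (by
        rw [injective_iff_map_eq_zero]
        intro y hy
        obtain ⟨w, rfl⟩ := Θ.surjective y
        rw [← hΦ] at hy
        rw [hker w hy, map_zero])
    have h2 : ⇑Φ = ⇑(1 + Q) ∘ ⇑Θ := funext hΦ
    rw [h2]
    exact h1.comp Θ.bijective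
  let e := ContinuousLinearEquiv.ofBijective Φ (LinearMap.ker_eq_bot.2 hbij.1)
    (LinearMap.range_eq_top.2 hbij.2)
  have he : ∀ w, e w = Φ w := fun _ => rfl
  refine ⟨e.symm.toContinuousLinearMap.comp (ContinuousLinearMap.inl ℂ _ _), fun f => ?_,
    fun w hw => ?_⟩
  · have h1 : Φ (e.symm (f, 0)) = (f, 0) := e.apply_symm_apply _
    exact ⟨(mem_bcSpace_iff c _).2 (congrArg Prod.snd h1), congrArg Prod.fst h1⟩
  · change e.symm (diffExprL c w + K w, 0) = w
    rw [ContinuousLinearEquiv.symm_apply_eq, he]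
    exact Prod.ext rfl ((mem_bcSpace_iff c w).1 hw).symm

end Operators

/-! ### A priori estimates in the sector. -/

section APriori

theorem sin_mul_norm_le_abs_im {ε : ℝ} (hε : 0 < ε) {z : ℂ} (h1 : ε < |z.arg|)
    (h2 : |z.arg| < Real.pi - ε) : Real.sin ε * ‖z‖ ≤ |z.im| := by
  have hs : Real.sin ε ≤ Real.sin |z.arg| := by
    rcases le_total |z.arg| (Real.pi / 2) with h | h
    · exact Real.sin_le_sin_of_le_of_le_pi_div_two (by linarith [Real.pi_pos]) h h1.le
    · rw [← Real.sin_pi_sub |z.arg|]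
      exact Real.sin_le_sin_of_le_of_le_pi_div_two (by linarith [Real.pi_pos]) (by linarith)
        (by linarith)
  have h3 : |z.im| = ‖z‖ * Real.sin |z.arg| := by
    rw [← Complex.norm_mul_sin_arg, abs_mul, abs_norm]
    congr 1
    rcases abs_cases z.arg with ⟨h, h0⟩ | ⟨h, h0⟩
    · rw [h, abs_of_nonneg (Real.sin_nonneg_of_nonneg_of_le_pi h0 (Complex.arg_le_pi z))]
    · rw [h, Real.sin_neg, abs_of_nonpos (Real.sin_nonpos_of_nonpos_of_neg_pi_le h0.le
        (Complex.neg_pi_lt_arg z).le)]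
  rw [h3, mul_comm]
  gcongr

/-- The real summand `p * s` does not enter the imaginary part, so its sign is irrelevant. -/
theorem norm_mul_le_of_im {k : ℝ} (hk : 0 < k) {z : ℂ} (hz : k * ‖z‖ ≤ |z.im|) (p s : ℝ) {t : ℝ}
    (ht : 0 ≤ t) : ‖z‖ * t ≤ k⁻¹ * ‖((p * s : ℝ) : ℂ) + z * (t : ℂ)‖ := by
  have h1 := Complex.abs_im_le_norm (((p * s : ℝ) : ℂ) + z * (t : ℂ))
  rw [Complex.add_im, Complex.ofReal_im, zero_add, Complex.im_mul_ofReal, abs_mul,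
    abs_of_nonneg ht] at h1
  rw [le_inv_mul_iff₀ hk, ← mul_assoc]
  exact (mul_le_mul_of_nonneg_right hz ht).trans h1

theorem abs_mul_le_of_im {k : ℝ} (hk : 0 < k) {z : ℂ} (hz : k * ‖z‖ ≤ |z.im|) (p : ℝ) {s t : ℝ}
    (hs : 0 ≤ s) (ht : 0 ≤ t) :
    |p| * s ≤ (1 + k⁻¹) * ‖((p * s : ℝ) : ℂ) + z * (t : ℂ)‖ := by
  have h1 := norm_mul_le_of_im hk hz p s ht
  have h2 : |p| * s = ‖((p * s : ℝ) : ℂ)‖ := by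
    rw [Complex.norm_real, Real.norm_eq_abs, abs_mul, abs_of_nonneg hs]
  have h3 : ‖((p * s : ℝ) : ℂ)‖ ≤ ‖((p * s : ℝ) : ℂ) + z * (t : ℂ)‖ + ‖z * (t : ℂ)‖ :=
    norm_le_add_norm_add _ _
  have h4 : ‖z * (t : ℂ)‖ = ‖z‖ * t := by rw [norm_mul, Complex.norm_real, Real.norm_of_nonneg ht]
  rw [h2]
  linarith

theorem norm_mul_add_le_of_im {k : ℝ} (hk : 0 < k) {z : ℂ} (hz : k * ‖z‖ ≤ |z.im|) {p : ℝ}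
    (hp : p ≠ 0) {s t Y : ℝ} (hs : 0 ≤ s) (ht : 0 ≤ t)
    (hY : ‖((p * s : ℝ) : ℂ) + z * (t : ℂ)‖ ≤ Y) :
    ‖z‖ * t + s ≤ (k⁻¹ + |p|⁻¹ * (1 + k⁻¹)) * Y := by
  have h1 := (norm_mul_le_of_im hk hz p s ht).trans (mul_le_mul_of_nonneg_left hY (by positivity))
  have h2 := (abs_mul_le_of_im hk hz p hs ht).trans (mul_le_mul_of_nonneg_left hY (by positivity))
  rw [← le_inv_mul_iff₀ (abs_pos.2 hp)] at h2
  linarith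

/-- A separated boundary condition bounds `|u u'|` by `|u|²`. -/
theorem norm_mul_norm_le_of_bc {α₀ α₁ : ℝ} (h : |α₀| + |α₁| ≠ 0) {u v : ℂ}
    (huv : (α₀ : ℂ) * u + α₁ * v = 0) : ‖u‖ * ‖v‖ ≤ |α₀ / α₁| * ‖u‖ ^ 2 := by
  -- For `α₁ = 0` the quotient `α₀ / α₁` is zero by convention, which is the right constant since
  -- then `u = 0`.
  rcases eq_or_ne α₁ 0 with rfl | h1
  · have h0 : α₀ ≠ 0 := fun h0 => h (by simp [h0])
    have : u = 0 := by simpa [h0] using huv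
    simp [this]
  · have h1' : (α₁ : ℂ) ≠ 0 := by exact_mod_cast h1
    have : v = -((α₀ / α₁ : ℝ) : ℂ) * u := by
      push_cast
      field_simp
      linear_combination huv
    rw [this, norm_mul, norm_neg, Complex.norm_real, Real.norm_eq_abs]
    exact le_of_eq (by ring)

theorem norm_mul_norm_le_of_transmission {γ δ : ℝ} {x y v : ℂ} (u : ℂ)
    (h : v - γ * x - δ * y = 0) (hu : u = x ∨ u = y) :
    ‖u‖ * ‖v‖ ≤ (|γ| + |δ|) * (‖x‖ ^ 2 + ‖y‖ ^ 2) := by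
  have hv : v = γ * x + δ * y := by linear_combination h
  have h1 : ‖v‖ ≤ |γ| * ‖x‖ + |δ| * ‖y‖ := by
    rw [hv]
    refine (norm_add_le _ _).trans_eq ?_
    simp
  have hx := norm_nonneg x
  have hy := norm_nonneg y
  have e1 : ‖u‖ * ‖x‖ ≤ ‖x‖ ^ 2 + ‖y‖ ^ 2 := by
    rcases hu with h | h <;> rw [h] <;> nlinarith [sq_nonneg (‖x‖ - ‖y‖)]
  have e2 : ‖u‖ * ‖y‖ ≤ ‖x‖ ^ 2 + ‖y‖ ^ 2 := by
    rcases hu with h | h <;> rw [h] <;> nlinarith [sq_nonneg (‖x‖ - ‖y‖)]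
  calc ‖u‖ * ‖v‖ ≤ ‖u‖ * (|γ| * ‖x‖ + |δ| * ‖y‖) := by gcongr
    _ = |γ| * (‖u‖ * ‖x‖) + |δ| * (‖u‖ * ‖y‖) := by ring
    _ ≤ |γ| * (‖x‖ ^ 2 + ‖y‖ ^ 2) + |δ| * (‖x‖ ^ 2 + ‖y‖ ^ 2) := by gcongr
    _ = _ := by ring

/-- Green's formula, after pairing the residual `p u'' - z u` with `u`; the inner term is then
estimated by Cauchy–Schwarz. -/
theorem norm_energy_le {a b : ℝ} (h : a < b) (p : ℝ) (z : ℂ) (w : Sob 2 a b) :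
    ‖((p * ‖Sob.der 1 w‖ ^ 2 : ℝ) : ℂ) + z * ((‖Sob.der 0 w‖ ^ 2 : ℝ) : ℂ)‖ ≤
      |p| * (‖Sob.rep h 0 w ⟨b, right_mem_Icc.2 h.le⟩‖ * ‖Sob.rep h 1 w ⟨b, right_mem_Icc.2 h.le⟩‖ +
        ‖Sob.rep h 0 w ⟨a, left_mem_Icc.2 h.le⟩‖ * ‖Sob.rep h 1 w ⟨a, left_mem_Icc.2 h.le⟩‖) +
      ‖Sob.der 0 w‖ * ‖(p : ℂ) • Sob.der 2 w - z • Sob.der 0 w‖ := by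
  have hG := Sob.inner_der_two h w
  set ub := Sob.rep h 0 w ⟨b, right_mem_Icc.2 h.le⟩
  set vb := Sob.rep h 1 w ⟨b, right_mem_Icc.2 h.le⟩
  set ua := Sob.rep h 0 w ⟨a, left_mem_Icc.2 h.le⟩
  set va := Sob.rep h 1 w ⟨a, left_mem_Icc.2 h.le⟩
  have e : ((p * ‖Sob.der 1 w‖ ^ 2 : ℝ) : ℂ) + z * ((‖Sob.der 0 w‖ ^ 2 : ℝ) : ℂ) =
      (p : ℂ) * (starRingEnd ℂ ub * vb - starRingEnd ℂ ua * va) -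
        inner ℂ (Sob.der 0 w) ((p : ℂ) • Sob.der 2 w - z • Sob.der 0 w) := by
    rw [inner_sub_right, inner_smul_right, inner_smul_right, hG, inner_self_eq_norm_sq_to_K]
    push_cast
    simp only [Complex.coe_algebraMap]
    ring
  rw [e]
  refine (norm_sub_le _ _).trans (add_le_add ?_ (norm_inner_le_norm _ _))
  rw [norm_mul, Complex.norm_real, Real.norm_eq_abs]
  refine mul_le_mul_of_nonneg_left ((norm_sub_le _ _).trans_eq ?_) (abs_nonneg _)
  simp only [norm_mul, RCLike.norm_conj]

/-- The sum of the squares of the boundary values. -/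
noncomputable def traceSq (w : W 2) : ℝ :=
  ‖valL 0 leftA w‖ ^ 2 + ‖valL 0 leftB w‖ ^ 2 + ‖valR 0 rightA w‖ ^ 2 + ‖valR 0 rightB w‖ ^ 2

/-- The square of the `L₂` norm of the first derivative. -/
noncomputable def derSq (w : W 2) : ℝ := ‖Sob.der 1 w.fst‖ ^ 2 + ‖Sob.der 1 w.snd‖ ^ 2

theorem norm_embL_sq (w : W 2) :
    ‖embL 2 w‖ ^ 2 = ‖Sob.der 0 w.fst‖ ^ 2 + ‖Sob.der 0 w.snd‖ ^ 2 :=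
  WithLp.prod_norm_sq_eq_of_L2 (embL 2 w)

theorem norm_sq_W_two (w : W 2) :
    ‖w‖ ^ 2 = ‖embL 2 w‖ ^ 2 + derSq w + (‖Sob.der 2 w.fst‖ ^ 2 + ‖Sob.der 2 w.snd‖ ^ 2) := by
  rw [WithLp.prod_norm_sq_eq_of_L2, Sob.norm_sq_eq, Sob.norm_sq_eq, Fin.sum_univ_three,
    Fin.sum_univ_three, norm_embL_sq, derSq]
  ring

theorem exists_traceSq_le {δ : ℝ} (hδ : 0 < δ) : ∃ C : ℝ, 0 < C ∧ ∀ w : W 2,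
    traceSq w ≤ δ * derSq w + C * ‖embL 2 w‖ ^ 2 := by
  obtain ⟨C₁, h₁, e₁⟩ := Sob.exists_norm_rep_sq_le left_lt leftA (half_pos hδ)
  obtain ⟨C₂, h₂, e₂⟩ := Sob.exists_norm_rep_sq_le left_lt leftB (half_pos hδ)
  obtain ⟨C₃, h₃, e₃⟩ := Sob.exists_norm_rep_sq_le right_lt rightA (half_pos hδ)
  obtain ⟨C₄, h₄, e₄⟩ := Sob.exists_norm_rep_sq_le right_lt rightB (half_pos hδ)
  refine ⟨C₁ + C₂ + C₃ + C₄, by positivity, fun w => ?_⟩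
  have g₁ : ‖valL 0 leftA w‖ ^ 2 ≤ _ := e₁ w.fst
  have g₂ : ‖valL 0 leftB w‖ ^ 2 ≤ _ := e₂ w.fst
  have g₃ : ‖valR 0 rightA w‖ ^ 2 ≤ _ := e₃ w.snd
  have g₄ : ‖valR 0 rightB w‖ ^ 2 ≤ _ := e₄ w.snd
  rw [norm_embL_sq, traceSq, derSq]
  have p₁ : 0 ≤ ‖Sob.der 0 w.fst‖ ^ 2 := by positivity
  have p₂ : 0 ≤ ‖Sob.der 0 w.snd‖ ^ 2 := by positivity
  nlinarith [mul_nonneg h₁.le p₂, mul_nonneg h₂.le p₂, mul_nonneg h₃.le p₁, mul_nonneg h₄.le p₁]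

theorem norm_der_zero_fst_le (w : W 2) : ‖Sob.der 0 w.fst‖ ≤ ‖embL 2 w‖ :=
  WithLp.norm_fst_le _ (embL 2 w)

theorem norm_der_zero_snd_le (w : W 2) : ‖Sob.der 0 w.snd‖ ≤ ‖embL 2 w‖ :=
  WithLp.norm_snd_le _ (embL 2 w)

theorem norm_residual_fst_le (c : Coeffs) (z : ℂ) (w : W 2) :
    ‖(c.p₁ : ℂ) • Sob.der 2 w.fst - z • Sob.der 0 w.fst‖ ≤ ‖diffExprL c w - z • embL 2 w‖ :=
  WithLp.norm_fst_le _ (diffExprL c w - z • embL 2 w)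

theorem norm_residual_snd_le (c : Coeffs) (z : ℂ) (w : W 2) :
    ‖(c.p₂ : ℂ) • Sob.der 2 w.snd - z • Sob.der 0 w.snd‖ ≤ ‖diffExprL c w - z • embL 2 w‖ :=
  WithLp.norm_snd_le _ (diffExprL c w - z • embL 2 w)

theorem traceSq_nonneg (w : W 2) : 0 ≤ traceSq w := by
  rw [traceSq]; positivity

theorem derSq_nonneg (w : W 2) : 0 ≤ derSq w := by
  rw [derSq]; positivity

theorem norm_boundary_left_le (c : Coeffs) (hα : |c.α₀| + |c.α₁| ≠ 0) {w : W 2}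
    (hw : w ∈ bcSpace c) :
    ‖valL 0 leftB w‖ * ‖valL 1 leftB w‖ + ‖valL 0 leftA w‖ * ‖valL 1 leftA w‖ ≤
      (|c.γ₀| + |c.δ₀| + |c.α₀ / c.α₁|) * traceSq w := by
  obtain ⟨⟨b1, -⟩, b3, -⟩ := (bcMap_eq_zero_iff c w).1 ((mem_bcSpace_iff c w).1 hw)
  have t1 := norm_mul_norm_le_of_bc hα b1
  have t3 := norm_mul_norm_le_of_transmission _ b3 (Or.inl rfl)
  have h1 : ‖valL 0 leftB w‖ ^ 2 + ‖valR 0 rightA w‖ ^ 2 ≤ traceSq w := by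
    rw [traceSq]
    linarith [sq_nonneg ‖valL 0 leftA w‖, sq_nonneg ‖valR 0 rightB w‖]
  have h2 : ‖valL 0 leftA w‖ ^ 2 ≤ traceSq w := by
    rw [traceSq]
    linarith [sq_nonneg ‖valL 0 leftB w‖, sq_nonneg ‖valR 0 rightA w‖, sq_nonneg ‖valR 0 rightB w‖]
  have h3 := mul_le_mul_of_nonneg_left h1 (add_nonneg (abs_nonneg c.γ₀) (abs_nonneg c.δ₀))
  have h4 := mul_le_mul_of_nonneg_left h2 (abs_nonneg (c.α₀ / c.α₁))
  rw [add_mul]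
  exact add_le_add (t3.trans h3) (t1.trans h4)

theorem norm_boundary_right_le (c : Coeffs) (hβ : |c.β₀| + |c.β₁| ≠ 0) {w : W 2}
    (hw : w ∈ bcSpace c) :
    ‖valR 0 rightB w‖ * ‖valR 1 rightB w‖ + ‖valR 0 rightA w‖ * ‖valR 1 rightA w‖ ≤
      (|c.β₀ / c.β₁| + (|c.γ₁| + |c.δ₁|)) * traceSq w := by
  obtain ⟨⟨-, b2⟩, -, b4⟩ := (bcMap_eq_zero_iff c w).1 ((mem_bcSpace_iff c w).1 hw)
  have t2 := norm_mul_norm_le_of_bc hβ b2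
  have t4 := norm_mul_norm_le_of_transmission _ b4 (Or.inr rfl)
  have h1 : ‖valL 0 leftB w‖ ^ 2 + ‖valR 0 rightA w‖ ^ 2 ≤ traceSq w := by
    rw [traceSq]
    linarith [sq_nonneg ‖valL 0 leftA w‖, sq_nonneg ‖valR 0 rightB w‖]
  have h2 : ‖valR 0 rightB w‖ ^ 2 ≤ traceSq w := by
    rw [traceSq]
    linarith [sq_nonneg ‖valL 0 leftB w‖, sq_nonneg ‖valR 0 rightA w‖, sq_nonneg ‖valL 0 leftA w‖]
  have h3 := mul_le_mul_of_nonneg_left h1 (add_nonneg (abs_nonneg c.γ₁) (abs_nonneg c.δ₁))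
  have h4 := mul_le_mul_of_nonneg_left h2 (abs_nonneg (c.β₀ / c.β₁))
  rw [add_mul]
  exact add_le_add (t2.trans h4) (t4.trans h3)

theorem energy_bound_arith {p B M τ f n F G : ℝ} (hM : 0 ≤ M) (hτ : 0 ≤ τ) (hB : B ≤ M * τ)
    (hf : f ≤ n) (hG : G ≤ F) (hG0 : 0 ≤ G) (hn : 0 ≤ n) :
    |p| * B + f * G ≤ (|p| * M + 1) * (τ + n * F) := by
  have h1 : |p| * B ≤ |p| * (M * τ) := mul_le_mul_of_nonneg_left hB (abs_nonneg p)
  have h2 : f * G ≤ n * F := mul_le_mul hf hG hG0 hn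
  have h3 : 0 ≤ |p| * M * (n * F) :=
    mul_nonneg (mul_nonneg (abs_nonneg p) hM) (mul_nonneg hn (hG0.trans hG))
  linarith

/-- The energy estimate, up to boundary values. -/
theorem exists_energy_le (c : Coeffs) (hp₁ : c.p₁ ≠ 0) (hp₂ : c.p₂ ≠ 0)
    (hα : |c.α₀| + |c.α₁| ≠ 0) (hβ : |c.β₀| + |c.β₁| ≠ 0) {k : ℝ} (hk : 0 < k) :
    ∃ L : ℝ, 0 < L ∧ ∀ z : ℂ, k * ‖z‖ ≤ |z.im| → ∀ w ∈ bcSpace c,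
      ‖z‖ * ‖embL 2 w‖ ^ 2 + derSq w ≤
        L * (traceSq w + ‖embL 2 w‖ * ‖diffExprL c w - z • embL 2 w‖) := by
  have q₁ : 0 < |c.p₁| := abs_pos.2 hp₁
  have q₂ : 0 < |c.p₂| := abs_pos.2 hp₂
  refine ⟨(k⁻¹ + |c.p₁|⁻¹ * (1 + k⁻¹)) * (|c.p₁| * (|c.γ₀| + |c.δ₀| + |c.α₀ / c.α₁|) + 1) +
    (k⁻¹ + |c.p₂|⁻¹ * (1 + k⁻¹)) * (|c.p₂| * (|c.β₀ / c.β₁| + (|c.γ₁| + |c.δ₁|)) + 1),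
    by positivity, fun z hz w hw => ?_⟩
  have g1 := (norm_energy_le left_lt c.p₁ z w.fst).trans (energy_bound_arith (by positivity)
    (traceSq_nonneg w) (norm_boundary_left_le c hα hw) (norm_der_zero_fst_le w)
    (norm_residual_fst_le c z w) (norm_nonneg _) (norm_nonneg _))
  have g2 := (norm_energy_le right_lt c.p₂ z w.snd).trans (energy_bound_arith (by positivity)
    (traceSq_nonneg w) (norm_boundary_right_le c hβ hw) (norm_der_zero_snd_le w)
    (norm_residual_snd_le c z w) (norm_nonneg _) (norm_nonneg _))
  have k1 := norm_mul_add_le_of_im hk hz hp₁ (sq_nonneg _) (sq_nonneg _) g1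
  have k2 := norm_mul_add_le_of_im hk hz hp₂ (sq_nonneg _) (sq_nonneg _) g2
  rw [norm_embL_sq, derSq]
  linarith

/-- The equation itself gives `p u''` as the residual plus `z u`. -/
theorem norm_der_two_le {a b : ℝ} {p : ℝ} (hp : p ≠ 0) (z : ℂ) (w : Sob 2 a b) {F n : ℝ}
    (h1 : ‖(p : ℂ) • Sob.der 2 w - z • Sob.der 0 w‖ ≤ F) (h2 : ‖Sob.der 0 w‖ ≤ n) :
    ‖Sob.der 2 w‖ ^ 2 ≤ (|p|⁻¹ * (F + ‖z‖ * n)) ^ 2 := by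
  have q : 0 < |p| := abs_pos.2 hp
  have h3 : |p| * ‖Sob.der 2 w‖ ≤ F + ‖z‖ * n := by
    calc |p| * ‖Sob.der 2 w‖ = ‖(p : ℂ) • Sob.der 2 w‖ := by
          rw [norm_smul, Complex.norm_real, Real.norm_eq_abs]
      _ = ‖((p : ℂ) • Sob.der 2 w - z • Sob.der 0 w) + z • Sob.der 0 w‖ := by rw [sub_add_cancel]
      _ ≤ ‖(p : ℂ) • Sob.der 2 w - z • Sob.der 0 w‖ + ‖z • Sob.der 0 w‖ := norm_add_le _ _
      _ ≤ F + ‖z‖ * n := by rw [norm_smul]; gcongr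
  rw [← le_inv_mul_iff₀ q] at h3
  gcongr

/-- The factor `1 / (2 * L)` lets half of `s` absorb the derivative part of the trace, and `Z > 2 L
C₁` lets half of `Z n²` absorb the rest. What remains is `Z n² + s ≤ 2 L n F`. -/
theorem energy_absorb_arith {L C₁ Z n s F τ : ℝ} (hL : 0 < L) (hZ1 : 1 < Z)
    (hZ : 2 * (L * C₁) < Z) (hn : 0 ≤ n) (hs : 0 ≤ s) (hF : 0 ≤ F)
    (h1 : Z * n ^ 2 + s ≤ L * (τ + n * F)) (h2 : τ ≤ 1 / (2 * L) * s + C₁ * n ^ 2) :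
    Z * n ≤ 2 * L * F ∧ n ≤ 2 * L * F ∧ s ≤ (2 * L * F) ^ 2 := by
  have h3 : Z * n ^ 2 / 2 + s / 2 ≤ L * (n * F) := by
    have e1 : L * τ ≤ s / 2 + L * C₁ * n ^ 2 := by
      calc L * τ ≤ L * (1 / (2 * L) * s + C₁ * n ^ 2) := by gcongr
        _ = _ := by field_simp
    have e2 : L * C₁ * n ^ 2 ≤ Z / 2 * n ^ 2 := by gcongr; linarith
    nlinarith
  have hZn : 0 ≤ Z * n ^ 2 := by positivity
  have h4 : Z * n ≤ 2 * L * F := by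
    rcases hn.eq_or_lt with h0 | h0
    · rw [← h0, mul_zero]; positivity
    · refine le_of_mul_le_mul_right ?_ h0
      nlinarith
  have h5 : n ≤ 2 * L * F := by nlinarith
  refine ⟨h4, h5, ?_⟩
  have e1 : s ≤ 2 * L * F * n := by nlinarith
  have e2 : 2 * L * F * n ≤ 2 * L * F * (2 * L * F) := by gcongr
  nlinarith

theorem inv_mul_add_sq_le {q F G L : ℝ} (hF : 0 ≤ F) (hG : 0 ≤ G) (h : G ≤ 2 * L * F) :
    (|q|⁻¹ * (F + G)) ^ 2 ≤ (|q|⁻¹ * (1 + 2 * L)) ^ 2 * F ^ 2 := by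
  rw [← mul_pow, mul_assoc]
  gcongr
  linarith

/-- The a priori estimate for `p u'' - z u` in a sector away from the real axis. -/
theorem exists_apriori (c : Coeffs) (hp₁ : c.p₁ ≠ 0) (hp₂ : c.p₂ ≠ 0)
    (hα : |c.α₀| + |c.α₁| ≠ 0) (hβ : |c.β₀| + |c.β₁| ≠ 0) {k : ℝ} (hk : 0 < k) :
    ∃ r : ℝ, 0 < r ∧ ∃ C : ℝ, 0 < C ∧ ∀ z : ℂ, r < ‖z‖ → k * ‖z‖ ≤ |z.im| → ∀ w ∈ bcSpace c,
      ‖w‖ ≤ C * ‖diffExprL c w - z • embL 2 w‖ ∧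
      ‖z‖ * ‖embL 2 w‖ ≤ C * ‖diffExprL c w - z • embL 2 w‖ := by
  obtain ⟨L, hL, hen⟩ := exists_energy_le c hp₁ hp₂ hα hβ hk
  obtain ⟨C₁, hC₁, htr⟩ := exists_traceSq_le (δ := 1 / (2 * L)) (by positivity)
  -- One summand each for `‖u‖²`, `‖u'‖²` and the two second derivatives, in units of `F²`.
  obtain ⟨Q, hQ⟩ : ∃ Q, Q = (2 * L) ^ 2 + (2 * L) ^ 2 + ((|c.p₁|⁻¹ * (1 + 2 * L)) ^ 2 +
    (|c.p₂|⁻¹ * (1 + 2 * L)) ^ 2) := ⟨_, rfl⟩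
  have hQ0 : 0 ≤ Q := by rw [hQ]; positivity
  refine ⟨max 1 (2 * (L * C₁)), by positivity, √Q + 2 * L, by positivity, fun z hr hz w hw => ?_⟩
  have hF0 : 0 ≤ ‖diffExprL c w - z • embL 2 w‖ := norm_nonneg _
  have hn0 : 0 ≤ ‖embL 2 w‖ := norm_nonneg _
  obtain ⟨h4, h5, h6⟩ := energy_absorb_arith hL ((le_max_left _ _).trans_lt hr)
    ((le_max_right _ _).trans_lt hr) hn0 (derSq_nonneg w) hF0 (hen z hz w hw) (htr w)
  have hzn : 0 ≤ ‖z‖ * ‖embL 2 w‖ := mul_nonneg (norm_nonneg _) hn0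
  have h7 := (norm_der_two_le hp₁ z w.fst (norm_residual_fst_le c z w)
    (norm_der_zero_fst_le w)).trans (inv_mul_add_sq_le hF0 hzn h4)
  have h8 := (norm_der_two_le hp₂ z w.snd (norm_residual_snd_le c z w)
    (norm_der_zero_snd_le w)).trans (inv_mul_add_sq_le hF0 hzn h4)
  have hW := norm_sq_W_two w
  generalize ‖diffExprL c w - z • embL 2 w‖ = F at *
  generalize ‖embL 2 w‖ = n at *
  have e1 : n ^ 2 ≤ (2 * L * F) ^ 2 := by gcongr
  have h10 : ‖w‖ ^ 2 ≤ Q * F ^ 2 := by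
    rw [hW, hQ]
    linarith
  have h11 : ‖w‖ ≤ √Q * F := by
    have := Real.le_sqrt_of_sq_le h10
    rwa [Real.sqrt_mul hQ0, Real.sqrt_sq hF0] at this
  have e2 : 0 ≤ 2 * L * F := by positivity
  have e3 : 0 ≤ √Q * F := by positivity
  constructor <;> linarith

/-- The a priori estimate for `p u'' + K u - z u` with a compact perturbation `K`. -/
theorem exists_apriori_add (c : Coeffs) (hp₁ : c.p₁ ≠ 0) (hp₂ : c.p₂ ≠ 0)
    (hα : |c.α₀| + |c.α₁| ≠ 0) (hβ : |c.β₀| + |c.β₁| ≠ 0) (K : W 2 →L[ℂ] H)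
    (hK : IsCompactOperator K) {k : ℝ} (hk : 0 < k) :
    ∃ r : ℝ, 0 < r ∧ ∃ C : ℝ, 0 < C ∧ ∀ z : ℂ, r < ‖z‖ → k * ‖z‖ ≤ |z.im| → ∀ w ∈ bcSpace c,
      ‖w‖ ≤ C * ‖diffExprL c w + K w - z • embL 2 w‖ := by
  obtain ⟨r, hr, C, hC, hap⟩ := exists_apriori c hp₁ hp₂ hα hβ hk
  -- With `δ = 1 / (4 * C)` and `|z| > 4 C C₁`, each part of Ehrling's bound for `‖K w‖` is at most
  -- `(G + ‖K w‖) / 4`, so `‖K w‖ ≤ G`.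
  obtain ⟨C₁, hC₁, hE⟩ := exists_norm_le_of_isCompactOperator (embL 2) (emb_injective 2) K hK
    (δ := 1 / (4 * C)) (by positivity)
  refine ⟨max r (4 * C * C₁), by positivity, 2 * C, by positivity, fun z hz hzk w hw => ?_⟩
  have hz1 : r < ‖z‖ := (le_max_left _ _).trans_lt hz
  have hz2 : 4 * C * C₁ < ‖z‖ := (le_max_right _ _).trans_lt hz
  have hz0 : 0 < ‖z‖ := hr.trans hz1
  obtain ⟨h1, h2⟩ := hap z hz1 hzk w hw
  have h3 := hE w
  have h4 : ‖diffExprL c w - z • embL 2 w‖ ≤ ‖diffExprL c w + K w - z • embL 2 w‖ + ‖K w‖ := by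
    have : diffExprL c w - z • embL 2 w = (diffExprL c w + K w - z • embL 2 w) - K w := by abel
    rw [this]
    exact norm_sub_le _ _
  have hy : 0 ≤ ‖K w‖ := norm_nonneg _
  have hn : 0 ≤ ‖embL 2 w‖ := norm_nonneg _
  generalize ‖diffExprL c w + K w - z • embL 2 w‖ = G at *
  generalize ‖diffExprL c w - z • embL 2 w‖ = F at *
  generalize ‖K w‖ = y at *
  generalize ‖embL 2 w‖ = n at *
  generalize ‖w‖ = m at *
  have h5 : m ≤ C * (G + y) := h1.trans (by gcongr)
  have h6 : ‖z‖ * n ≤ C * (G + y) := h2.trans (by gcongr)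
  have h7 : 1 / (4 * C) * m ≤ (G + y) / 4 := by
    calc _ ≤ 1 / (4 * C) * (C * (G + y)) := by gcongr
      _ = _ := by field_simp
  have h8 : C₁ * n ≤ (G + y) / 4 := by
    have e : 4 * C * (C₁ * n) ≤ C * (G + y) := by
      calc _ = (4 * C * C₁) * n := by ring
        _ ≤ ‖z‖ * n := by gcongr
        _ ≤ _ := h6
    have e' : C * (4 * (C₁ * n)) ≤ C * (G + y) := by linarith
    have := le_of_mul_le_mul_left e' hC
    linarith
  have h9 : y ≤ G := by linarith
  calc m ≤ C * (G + y) := h5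
    _ ≤ C * (G + G) := by gcongr
    _ = _ := by ring

end APriori

/-! ### Root vectors and eigenvectors seen through the resolvent. -/

section Resolvent

variable {E : Type*} [NormedAddCommGroup E] [NormedSpace ℂ E]

/-- A root vector of `S` at `z` is a root vector of the resolvent at `z₀` for the eigenvalue
`(z - z₀)⁻¹`. -/
theorem IsResolventAt.kerPow_le {S : E →ₗ.[ℂ] E} {z₀ z : ℂ} {R : E →L[ℂ] E}
    (hR : IsResolventAt S z₀ R) (hz : z ≠ z₀) (n : ℕ) :
    kerPow S z n ≤ Module.End.maxGenEigenspace (R : Module.End ℂ E) (z - z₀)⁻¹ := by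
  have hne : z - z₀ ≠ 0 := sub_ne_zero.2 hz
  induction n with
  | zero => exact bot_le
  | succ n ih =>
    rintro _ ⟨u, hu, rfl⟩
    set N := Module.End.maxGenEigenspace (R : Module.End ℂ E) (z - z₀)⁻¹ with hN
    have h1 : S u - z • (u : E) ∈ N := ih hu
    have h2 : R (S u - z₀ • (u : E)) = u := hR.2 u
    have h3 : R (S u - z • (u : E)) ∈ N :=
      Module.End.mapsTo_maxGenEigenspace_of_comm (f := (R : Module.End ℂ E)) (Commute.refl _) _ h1
    -- Applying `R` to `(S - z₀) u = (S - z) u + (z - z₀) u` shows that `R - (z - z₀)⁻¹` sends `u`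
    -- into `N`; a further power of it then kills `u`.
    have h4 : R (u : E) - (z - z₀)⁻¹ • (u : E) = -((z - z₀)⁻¹ • R (S u - z • (u : E))) := by
      have e : S u - z₀ • (u : E) = (S u - z • (u : E)) + (z - z₀) • (u : E) := by module
      rw [e, map_add, map_smul] at h2
      have h5 : (z - z₀)⁻¹ • (R (S u - z • (u : E)) + (z - z₀) • R (u : E)) =
          (z - z₀)⁻¹ • (u : E) := by rw [h2]
      rw [smul_add, inv_smul_smul₀ hne] at h5
      rw [← h5]; abel
    have h6 : ((R : Module.End ℂ E) - (z - z₀)⁻¹ • (1 : Module.End ℂ E)) (u : E) ∈ N := by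
      change R (u : E) - (z - z₀)⁻¹ • (u : E) ∈ N
      rw [h4]
      exact N.neg_mem (N.smul_mem _ h3)
    rw [hN, Module.End.mem_maxGenEigenspace] at h6
    obtain ⟨k, hk⟩ := h6
    change (u : E) ∈ N
    rw [hN, Module.End.mem_maxGenEigenspace]
    exact ⟨k + 1, by rw [pow_succ]; exact hk⟩

theorem IsResolventAt.hasEigenvector {S : E →ₗ.[ℂ] E} {z₀ z : ℂ} {R : E →L[ℂ] E}
    (hR : IsResolventAt S z₀ R) (hz : z ≠ z₀) {u : S.domain} (hu : (u : E) ≠ 0)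
    (h : S u = z • (u : E)) :
    Module.End.HasEigenvector (R : Module.End ℂ E) (z - z₀)⁻¹ (u : E) := by
  have hne : z - z₀ ≠ 0 := sub_ne_zero.2 hz
  refine ⟨Module.End.mem_eigenspace_iff.2 ?_, hu⟩
  have h2 : R (S u - z₀ • (u : E)) = u := hR.2 u
  rw [h, ← sub_smul, map_smul] at h2
  change R (u : E) = (z - z₀)⁻¹ • (u : E)
  rw [eq_inv_smul_iff₀ hne]
  exact h2

theorem IsResolventAt.eq_zero {S : E →ₗ.[ℂ] E} {z : ℂ} {R : E →L[ℂ] E}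
    (hR : IsResolventAt S z R) {u : S.domain} (h : S u = z • (u : E)) : (u : E) = 0 := by
  rw [← hR.2 u, h, sub_self, map_zero]

end Resolvent

/-- An operator in a Hilbert space with a compact resolvent whose spectrum consists of eigenvalues
has discrete spectrum. -/
theorem hasDiscreteSpectrum_of_isCompactOperator {E : Type*} [NormedAddCommGroup E]
    [InnerProductSpace ℂ E] {S : E →ₗ.[ℂ] E} {z₀ : ℂ} {R : E →L[ℂ] E}
    (hR : IsResolventAt S z₀ R) (hRc : IsCompactOperator R)
    (hS : ∀ z ∈ spec S, IsEigenvalue S z) : HasDiscreteSpectrum S := by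
  have hne : ∀ z ∈ spec S, z ≠ z₀ := by
    rintro z hz rfl
    exact hz ⟨R, hR⟩
  refine ⟨fun z hz => ⟨hS z hz, ?_⟩, fun z hz => ?_⟩
  · have hz0 := sub_ne_zero.2 (hne z hz)
    have := finiteDimensional_iSup_maxGenEigenspace R hRc (r := ‖(z - z₀)⁻¹‖)
      (norm_pos_iff.2 (inv_ne_zero hz0))
    refine Submodule.finiteDimensional_of_le (S₂ := ⨆ μ : {μ : ℂ // ‖(z - z₀)⁻¹‖ ≤ ‖μ‖},
      Module.End.maxGenEigenspace (R : Module.End ℂ E) μ) (iSup_le fun n => ?_)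
    exact (hR.kerPow_le (hne z hz) n).trans
      (le_iSup (fun μ : {μ : ℂ // ‖(z - z₀)⁻¹‖ ≤ ‖μ‖} =>
        Module.End.maxGenEigenspace (R : Module.End ℂ E) μ) ⟨(z - z₀)⁻¹, le_rfl⟩)
  -- Spectral points within 1 of `z` give distinct eigenvalues of `R` of modulus at least `ρ⁻¹`;
  -- their independent eigenvectors lie in one finite dimensional space.
  · set ρ := ‖z - z₀‖ + 1 with hρ
    have hρ0 : 0 < ρ := by positivity
    have hfd := finiteDimensional_iSup_maxGenEigenspace R hRc (r := ρ⁻¹) (inv_pos.2 hρ0)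
    set V : Submodule ℂ E := ⨆ μ : {μ : ℂ // ρ⁻¹ ≤ ‖μ‖},
      Module.End.maxGenEigenspace (R : Module.End ℂ E) μ with hV
    have hfin : (spec S ∩ Metric.ball z 1).Finite := by
      rw [← Set.finite_coe_iff]
      have hev : ∀ y : ↥(spec S ∩ Metric.ball z 1), ∃ v : E,
          Module.End.HasEigenvector (R : Module.End ℂ E) ((y : ℂ) - z₀)⁻¹ v := by
        rintro ⟨y, hy, -⟩
        obtain ⟨u, hu, h⟩ := hS y hy
        exact ⟨u, hR.hasEigenvector (hne y hy) hu h⟩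
      choose v hv using hev
      have hinj : Function.Injective fun y : ↥(spec S ∩ Metric.ball z 1) => ((y : ℂ) - z₀)⁻¹ := by
        intro y y' h
        exact Subtype.ext (sub_left_injective (inv_injective h))
      have hli := Module.End.eigenvectors_linearIndependent' (R : Module.End ℂ E) _ hinj v hv
      have hmem : ∀ y, v y ∈ V := by
        intro y
        have hy := hne y y.2.1
        have hb := y.2.2
        rw [Metric.mem_ball, dist_eq_norm] at hb
        have h1 : ‖(y : ℂ) - z₀‖ ≤ ρ := by
          have : (y : ℂ) - z₀ = ((y : ℂ) - z) + (z - z₀) := by ring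
          rw [this, hρ]
          exact (norm_add_le _ _).trans (by linarith)
        have h2 : ρ⁻¹ ≤ ‖((y : ℂ) - z₀)⁻¹‖ := by
          rw [norm_inv]
          exact inv_anti₀ (norm_pos_iff.2 (sub_ne_zero.2 hy)) h1
        have h3 : v y ∈ Module.End.maxGenEigenspace (R : Module.End ℂ E) ((y : ℂ) - z₀)⁻¹ := by
          rw [Module.End.mem_maxGenEigenspace]
          refine ⟨1, ?_⟩
          rw [pow_one]
          have := (hv y).apply_eq_smul
          change (R : Module.End ℂ E) (v y) - ((y : ℂ) - z₀)⁻¹ • v y = 0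
          rw [this, sub_self]
        exact (le_iSup (fun μ : {μ : ℂ // ρ⁻¹ ≤ ‖μ‖} =>
          Module.End.maxGenEigenspace (R : Module.End ℂ E) μ) ⟨_, h2⟩) h3
      have hli' : LinearIndependent ℂ fun y => (⟨v y, hmem y⟩ : V) :=
        LinearIndependent.of_comp V.subtype hli
      exact hli'.finite
    have h1 : AccPt z (Filter.principal (spec S ∩ Metric.ball z 1)) := by
      rw [accPt_iff_frequently_nhdsNE] at hz ⊢
      refine (hz.and_eventually (nhdsWithin_le_nhds (Metric.ball_mem_nhds z one_pos))).mono ?_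
      rintro y ⟨h1, h2⟩
      exact ⟨h1, h2⟩
    exact Set.Infinite.of_accPt h1 hfin

/-! ### The operator `£`: solvability and lifting of the resolvent to `W₂²`. -/

section Main

variable {c : Coeffs} {A : H →ₗ.[ℂ] H}

theorem domain_opL₀_le (hdom : ∀ w : W 2, emb 2 w ∈ A.domain) : (opL₀ c).domain ≤ A.domain := by
  rintro _ ⟨w, -, rfl⟩
  exact hdom w

/-- The perturbation `A` as a linear map on `W₂²`. -/
noncomputable def perturbation (A : H →ₗ.[ℂ] H) (hdom : ∀ w : W 2, emb 2 w ∈ A.domain) :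
    W 2 →ₗ[ℂ] H :=
  A.toFun ∘ₗ (emb 2).codRestrict A.domain hdom

theorem mem_domain_opL (hdom : ∀ w : W 2, emb 2 w ∈ A.domain) {u : H} :
    u ∈ (opL c A).domain ↔ ∃ w ∈ bcSpace c, emb 2 w = u := by
  rw [opL_domain c A (domain_opL₀_le hdom)]
  rfl

theorem opL_apply (hdom : ∀ w : W 2, emb 2 w ∈ A.domain) {w : W 2} (hw : w ∈ bcSpace c)
    (hm : emb 2 w ∈ (opL c A).domain) :
    opL c A ⟨emb 2 w, hm⟩ = diffExpr c w + perturbation A hdom w := by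
  have h1 : opL c A ⟨emb 2 w, hm⟩ = opL₀ c ⟨emb 2 w, hm.1⟩ + A ⟨emb 2 w, hm.2⟩ :=
    LinearPMap.add_apply _ _ _
  rw [h1, opL₀_apply c w hw]
  rfl

theorem isResolventAt_of_solution_operator (hdom : ∀ w : W 2, emb 2 w ∈ A.domain) {z : ℂ}
    {T : H →L[ℂ] W 2}
    (h1 : ∀ f, T f ∈ bcSpace c ∧ diffExpr c (T f) + (perturbation A hdom (T f) - z • emb 2 (T f)) = f)
    (h2 : ∀ w ∈ bcSpace c, T (diffExpr c w + (perturbation A hdom w - z • emb 2 w)) = w) :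
    IsResolventAt (opL c A) z ((embL 2).comp T) := by
  refine ⟨fun f => ?_, fun u => ?_⟩
  · have hm : emb 2 (T f) ∈ (opL c A).domain := (mem_domain_opL hdom).2 ⟨_, (h1 f).1, rfl⟩
    refine ⟨hm, ?_⟩
    change opL c A ⟨emb 2 (T f), hm⟩ - z • emb 2 (T f) = f
    rw [opL_apply hdom (h1 f).1, add_sub_assoc]
    exact (h1 f).2
  · obtain ⟨u, hu⟩ := u
    obtain ⟨w, hw, rfl⟩ := (mem_domain_opL hdom).1 hu
    change emb 2 (T (opL c A ⟨emb 2 w, hu⟩ - z • emb 2 w)) = emb 2 w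
    rw [opL_apply hdom hw, add_sub_assoc, h2 w hw]

/-- Either `z` is an eigenvalue or the boundary value problem is solvable. -/
theorem exists_isResolventAt (hp₁ : c.p₁ ≠ 0) (hp₂ : c.p₂ ≠ 0)
    (hdom : ∀ w : W 2, emb 2 w ∈ A.domain) (hcomp : IsCompactOperator (perturbation A hdom)) {z : ℂ}
    (hinj : ∀ w ∈ bcSpace c, diffExpr c w + (perturbation A hdom w - z • emb 2 w) = 0 → w = 0) :
    ∃ T : H →L[ℂ] W 2, (∀ f, T f ∈ bcSpace c ∧
        diffExpr c (T f) + (perturbation A hdom (T f) - z • emb 2 (T f)) = f) ∧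
      IsResolventAt (opL c A) z ((embL 2).comp T) := by
  let K : W 2 →L[ℂ] H := ContinuousLinearMap.mkOfIsCompactOperator hcomp
  have hK : IsCompactOperator (K - z • embL 2) :=
    IsCompactOperator.sub hcomp (isCompactOperator_embL.smul z)
  obtain ⟨T, h1, h2⟩ := exists_solution_operator hp₁ hp₂ (K - z • embL 2) hK hinj
  exact ⟨T, h1, isResolventAt_of_solution_operator hdom h1 h2⟩

/-- Every resolvent factors through `W₂²`. -/
theorem IsResolventAt.exists_lift (hdom : ∀ w : W 2, emb 2 w ∈ A.domain) {z : ℂ} {R : H →L[ℂ] H}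
    (hR : IsResolventAt (opL c A) z R) : ∃ T : H →L[ℂ] W 2, ∀ f, emb 2 (T f) = R f := by
  have h : ∀ f, ∃ w : W 2, emb 2 w = R f := fun f => by
    obtain ⟨hm, -⟩ := hR.1 f
    obtain ⟨w, -, hw⟩ := (mem_domain_opL hdom).1 hm
    exact ⟨w, hw⟩
  choose T hT using h
  let T' : H →ₗ[ℂ] W 2 :=
    { toFun := T
      map_add' := fun f g => emb_injective 2 (by rw [map_add, hT, hT, hT, map_add])
      map_smul' := fun a f => emb_injective 2 (by rw [RingHom.id_apply, map_smul, hT, hT, map_smul]) }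
  have hT' : ∀ f, embL 2 (T' f) = R f := hT
  -- The closed graph theorem suffices: the embedding is continuous and injective, and its
  -- composition with `T'` is the bounded `R`.
  have hcont : Continuous T' := T'.continuous_of_seq_closed_graph fun u x y hu hy => by
    refine emb_injective 2 ?_
    have h1 : Filter.Tendsto (fun n => embL 2 (T' (u n))) Filter.atTop (𝓝 (embL 2 y)) :=
      ((embL 2).continuous.tendsto y).comp hy
    simp only [hT'] at h1
    have h2 := tendsto_nhds_unique h1 ((R.continuous.tendsto x).comp hu)
    exact h2.trans (hT' x).symm
  exact ⟨⟨T', hcont⟩, hT⟩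

end Main

end TransSL

theorem mainTheorem8 (c : TransSL.Coeffs)
    (hp₁ : c.p₁ ≠ 0) (hp₂ : c.p₂ ≠ 0)
    (hα : |c.α₀| + |c.α₁| ≠ 0) (hβ : |c.β₀| + |c.β₁| ≠ 0)
    (hsym : c.p₁ * c.δ₀ = c.p₂ * c.γ₁)
    (A : TransSL.H →ₗ.[ℂ] TransSL.H)
    (hdom : ∀ w : TransSL.W 2, TransSL.emb 2 w ∈ A.domain)
    (hcomp : IsCompactOperator (fun w : TransSL.W 2 => A ⟨TransSL.emb 2 w, hdom w⟩)) :
    -- at every regular value the resolvent is bounded into `W₂²` and compact in `L₂`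
    (∀ (z : ℂ) (R : TransSL.H →L[ℂ] TransSL.H),
      TransSL.IsResolventAt (TransSL.opL c A) z R →
        (∃ T : TransSL.H →L[ℂ] TransSL.W 2, ∀ f, TransSL.emb 2 (T f) = R f) ∧
          IsCompactOperator R) ∧
    -- all large `z` away from the real axis are regular, with a uniform bound into `W₂²`
    (∀ ε : ℝ, 0 < ε → ∃ r : ℝ, 0 < r ∧ ∃ C : ℝ, 0 < C ∧ ∀ z : ℂ, r < ‖z‖ →
      ε < |z.arg| → |z.arg| < Real.pi - ε →
        ∃ R : TransSL.H →L[ℂ] TransSL.H, TransSL.IsResolventAt (TransSL.opL c A) z R ∧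
          ∃ T : TransSL.H →L[ℂ] TransSL.W 2,
            (∀ f, TransSL.emb 2 (T f) = R f) ∧ ∀ f, ‖T f‖ ≤ C * ‖f‖) ∧
    TransSL.HasDiscreteSpectrum (TransSL.opL c A) := by
  have hK : IsCompactOperator (TransSL.perturbation A hdom) := hcomp
  have compact : ∀ (z : ℂ) (R : TransSL.H →L[ℂ] TransSL.H),
      TransSL.IsResolventAt (TransSL.opL c A) z R →
        (∃ T : TransSL.H →L[ℂ] TransSL.W 2, ∀ f, TransSL.emb 2 (T f) = R f) ∧
          IsCompactOperator R := by
    intro z R hR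
    obtain ⟨T, hT⟩ := hR.exists_lift hdom
    refine ⟨⟨T, hT⟩, ?_⟩
    have e : ⇑R = ⇑(TransSL.embL 2) ∘ ⇑T := funext fun f => (hT f).symm
    rw [e]
    exact TransSL.isCompactOperator_embL.comp_clm T
  have sector : ∀ ε : ℝ, 0 < ε → ∃ r : ℝ, 0 < r ∧ ∃ C : ℝ, 0 < C ∧ ∀ z : ℂ, r < ‖z‖ →
      ε < |z.arg| → |z.arg| < Real.pi - ε →
        ∃ R : TransSL.H →L[ℂ] TransSL.H, TransSL.IsResolventAt (TransSL.opL c A) z R ∧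
          ∃ T : TransSL.H →L[ℂ] TransSL.W 2,
            (∀ f, TransSL.emb 2 (T f) = R f) ∧ ∀ f, ‖T f‖ ≤ C * ‖f‖ := by
    intro ε hε
    -- The estimate needs `sin ε > 0`; for `ε ≥ π` the sector is empty.
    rcases lt_or_ge ε Real.pi with hεπ | hεπ
    · obtain ⟨r, hr, C, hC, h⟩ := TransSL.exists_apriori_add c hp₁ hp₂ hα hβ
        (ContinuousLinearMap.mkOfIsCompactOperator hK) hK (Real.sin_pos_of_pos_of_lt_pi hε hεπ)
      refine ⟨r, hr, C, hC, fun z hz h1 h2 => ?_⟩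
      have hap : ∀ w ∈ TransSL.bcSpace c, ‖w‖ ≤ C * ‖TransSL.diffExpr c w +
          (TransSL.perturbation A hdom w - z • TransSL.emb 2 w)‖ := fun w hw => by
        rw [← add_sub_assoc]
        exact h z hz (TransSL.sin_mul_norm_le_abs_im hε h1 h2) w hw
      obtain ⟨T, hT, hR⟩ := TransSL.exists_isResolventAt hp₁ hp₂ hdom hK (z := z)
        fun w hw h0 => by
          have := hap w hw
          rw [h0, norm_zero, mul_zero] at this
          exact norm_le_zero_iff.1 this
      refine ⟨_, hR, T, fun f => rfl, fun f => ?_⟩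
      have := hap (T f) (hT f).1
      rwa [(hT f).2] at this
    · exact ⟨1, one_pos, 1, one_pos, fun z _ h1 h2 => by linarith⟩
  refine ⟨compact, sector, ?_⟩
  -- A single regular value is enough for the Riesz theory: a point high on the imaginary axis,
  -- where `1 < π / 2 < π - 1`.
  obtain ⟨r, hr, C, -, h⟩ := sector 1 one_pos
  have harg : ((((r + 1 : ℝ) : ℂ) * Complex.I)).arg = Real.pi / 2 := by
    rw [Complex.arg_real_mul _ (by linarith), Complex.arg_I]
  obtain ⟨R, hR, -⟩ := h (((r + 1 : ℝ) : ℂ) * Complex.I)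
    (by
      rw [norm_mul, Complex.norm_I, mul_one, Complex.norm_real, Real.norm_of_nonneg (by linarith)]
      linarith)
    (by rw [harg, abs_of_pos (by positivity)]; linarith [Real.pi_gt_three])
    (by rw [harg, abs_of_pos (by positivity)]; linarith [Real.pi_gt_three])
  refine TransSL.hasDiscreteSpectrum_of_isCompactOperator hR (compact _ R hR).2 fun z hz => ?_
  -- If `z` is not an eigenvalue, the homogeneous problem has only the zero solution, so the
  -- Fredholm alternative makes `z` regular.
  by_contra hne
  refine hz ?_
  obtain ⟨T, -, hT⟩ := TransSL.exists_isResolventAt hp₁ hp₂ hdom hK (z := z) fun w hw h0 => by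
    by_contra hw0
    have hm := (TransSL.mem_domain_opL hdom).2 ⟨w, hw, rfl⟩
    refine hne ⟨⟨TransSL.emb 2 w, hm⟩, fun h => hw0 (TransSL.emb_injective 2 (h.trans
      (map_zero _).symm)), ?_⟩
    rw [TransSL.opL_apply hdom hw]
    rw [← add_sub_assoc] at h0
    exact sub_eq_zero.1 h0
  exact ⟨_, hT⟩
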